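/- Let $(A,\mathfrak m)$ be a $d$-dimensional normal Noetherian local domain of characteristic $p>0$ that is F-finite (the Frobenius endomorphism of $A$ is finite), with quotient field $L$, and let $\Delta$ be an effective $\mathbb Q$-Weil divisor on $Y=\operatorname{Spec}A$. For a $\mathbb Q$-Weil divisor $D$ put $A(D)=\{f\in L\mid f=0 \text{ or } \operatorname{div}_Y(f)+D\ge 0\}$. Let $K_A$ be a canonical divisor of $A$, i.e. an integral Weil divisor such that $A(K_A)$ is a canonical module of $A$ (a finitely generated module $\omega$ with $\operatorname{Hom}_A(\omega,E_A(A/\mathfrak m))\cong H^d_{\mathfrak m}(A)$), and write $H^d_{\mathfrak m}(K_A)=H^d_{\mathfrak m}(A(K_A))$. The letter $q$ denotes a power $q=p^e$ with $e\ge 1$, and $M^{1/q}$ denotes an $A$-module $M$ with $a\in A$ acting as multiplication by $a^q$; for $m\in M$ write $m^{1/q}$ for $m$ regarded as an element of $M^{1/q}$. For $c\in A$ let $\iota_{c,q}\colon A\to A((q-1)\Delta)^{1/q}$ be the $A$-linear map $a\mapsto (c\,a^q)^{1/q}$. The pair $(A,\Delta)$ is called * F-pure if $\iota_{1,q}$ splits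 as a map of $A$-modules for every $q$; * strongly F-regular if for every nonzero $c\in A$ there exists $q$ such that $\iota_{c,q}$ splits; * divisorially F-regular if for every nonzero $c\in A$ that lies in no minimal prime of the ideal $A(-\lfloor\Delta\rfloor)\subseteq A$ there exists $q$ such that $\iota_{c,q}$ splits. Let $F^e\colon H^d_{\mathfrak m}(K_A)\to H^d_{\mathfrak m}(A(qK_A+(q-1)\Delta))$ be the map induced by the $A$-linear map $A(K_A)\to A(qK_A+(q-1)\Delta)^{1/q}$, $f\mapsto (f^q)^{1/q}$, where $H^d_{\mathfrak m}(M^{1/q})$ is identified with $H^d_{\mathfrak m}(M)^{1/q}$; let $cF^e$ be $F^e$ followed by multiplication by $c$. Then: 1. $(A,\Delta)$ is F-pure if and only if for every $q=p^e$ the map $F^e\colon H^d_{\mathfrak m}(K_A)\to H^d_{\mathfrak m}(A(qK_A+(q-1)\Delta))$ is injective. 2. $(A,\Delta)$ is strongly F-regular if and only if for every nonzero $c\in A$ there exists $q=p^e$ such that $cF^e\colon H^d_{\mathfrak m}(K_A)\to H^d_{\mathfrak m}(A(qK_A+(q-1)\Delta))$ is injective. 3. $(A,\Delta)$ is divisorially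 F-regular if and only if for every nonzero $c\in A$ that lies in no minimal prime of $A(-\lfloor\Delta\rfloor)$ there exists $q=p^e$ such that $cF^e\colon H^d_{\mathfrak m}(K_A)\to H^d_{\mathfrak m}(A(qK_A+(q-1)\Delta))$ is injective. -/

import Mathlib

open CategoryTheory

universe u

noncomputable section

/-! ### Weil divisors on `Spec A` and the divisorial modules `A(D)` -/

/-- The prime divisors of `Spec A`: the prime ideals of height one. -/
abbrev HeightOnePrime (A : Type*) [CommRing A] : Type _ :=
  {P : PrimeSpectrum A // P.asIdeal.height = 1}

/-- Weil divisors on `Spec A` with coefficients in `R`: the case `R = ℤ` gives integral Weil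
divisors and `R = ℚ` gives `ℚ`-Weil divisors. -/
abbrev WeilDivisor (A : Type*) [CommRing A] (R : Type*) [Zero R] : Type _ :=
  HeightOnePrime A →₀ R

namespace WeilDivisor

variable {A : Type*} [CommRing A]

/-- An integral Weil divisor regarded as a `ℚ`-Weil divisor. -/
def toRat (D : WeilDivisor A ℤ) : WeilDivisor A ℚ :=
  Finsupp.mapRange (fun n : ℤ => (n : ℚ)) Int.cast_zero D

/-- The round-down of a `ℚ`-Weil divisor, again regarded as a `ℚ`-Weil divisor. -/
def floor (D : WeilDivisor A ℚ) : WeilDivisor A ℚ :=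
  Finsupp.mapRange (fun t : ℚ => ((⌊t⌋ : ℤ) : ℚ)) (by simp) D

end WeilDivisor

section Divisorial

variable {A : Type*} [CommRing A] [IsDomain A]
variable (L : Type*) [Field L] [Algebra A L] [IsFractionRing A L]

/-- The local ring `A_P` of a height one prime `P`, as a subring of the quotient field `L`. -/
abbrev localRingAt (P : HeightOnePrime A) : Subalgebra A L :=
  Localization.subalgebra.ofField L P.1.asIdeal.primeCompl
    P.1.asIdeal.primeCompl_le_nonZeroDivisors

/-- In a normal Noetherian domain the local ring at a height one prime is a discrete valuation
ring. -/
instance localRingAt.isDiscreteValuationRing [IsNoetherianRing A] [IsIntegrallyClosed A]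
    (P : HeightOnePrime A) : IsDiscreteValuationRing (localRingAt L P) := by
  have hloc : IsLocalization.AtPrime (localRingAt L P) P.1.asIdeal :=
    Localization.subalgebra.isLocalization_ofField L _ _
  have : IsLocalRing (localRingAt L P) := IsLocalization.AtPrime.isLocalRing _ P.1.asIdeal
  have : IsNoetherianRing (localRingAt L P) :=
    IsLocalization.isNoetherianRing P.1.asIdeal.primeCompl _ inferInstance
  have : IsIntegrallyClosed (localRingAt L P) :=
    isIntegrallyClosed_of_isLocalization _ P.1.asIdeal.primeCompl
      P.1.asIdeal.primeCompl_le_nonZeroDivisors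
  have hdim : ringKrullDim (localRingAt L P) = 1 := by
    rw [IsLocalization.AtPrime.ringKrullDim_eq_height P.1.asIdeal, P.2]
    rfl
  have hnf : ¬ IsField (localRingAt L P) := fun h => by
    rw [ringKrullDim_eq_zero_of_isField h] at hdim
    exact zero_ne_one hdim
  have hle : Ring.KrullDimLE 1 (localRingAt L P) := Ring.krullDimLE_iff.mpr hdim.le
  have h3 : IsIntegrallyClosed (localRingAt L P) ∧
      ∃! Q : Ideal (localRingAt L P), Q ≠ ⊥ ∧ Q.IsPrime := by
    refine ⟨inferInstance, IsLocalRing.maximalIdeal _, ⟨?_, inferInstance⟩, ?_⟩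
    · exact fun h => hnf (IsLocalRing.isField_iff_maximalIdeal_eq.mpr h)
    · rintro Q ⟨hQ, hQ'⟩
      have := Ring.krullDimLE_one_iff_of_noZeroDivisors.mp hle Q hQ hQ'
      exact IsLocalRing.eq_maximalIdeal this
  exact ((IsDiscreteValuationRing.TFAE _ hnf).out 0 3).mpr h3

variable [IsNoetherianRing A] [IsIntegrallyClosed A]

/-- The (multiplicative) normalized discrete valuation of `L` with valuation ring `A_P`; it takes
the value `exp (-1)` at a uniformizer of `A_P`. -/
def valuationAt (P : HeightOnePrime A) : Valuation L (WithZero (Multiplicative ℤ)) :=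
  (IsDiscreteValuationRing.maximalIdeal (localRingAt L P)).valuation L

variable {L} in
/-- The coefficient of `div f` at the prime divisor `P`, for `f ∈ L` nonzero
(with the convention `ordAt P 0 = 0`). -/
def ordAt (P : HeightOnePrime A) (f : L) : ℤ := -WithZero.log (valuationAt L P f)

variable {L} in
/-- The order is at least `-t` exactly when the valuation is at most `exp ⌊t⌋`. -/
theorem ordAt_nonneg_iff (P : HeightOnePrime A) {f : L} (hf : f ≠ 0) (t : ℚ) :
    0 ≤ (ordAt P f : ℚ) + t ↔ valuationAt L P f ≤ WithZero.exp ⌊t⌋ := by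
  have hv : valuationAt L P f ≠ 0 := (Valuation.ne_zero_iff _).mpr hf
  rw [← WithZero.log_le_iff_le_exp hv, Int.le_floor, ordAt]
  push_cast
  constructor <;> intro h <;> linarith

/-- `A(D) = {f ∈ L ∣ div f + D ≥ 0}` (together with `0`), an `A`-submodule of the quotient
field `L`. -/
def divisorialModule (D : WeilDivisor A ℚ) : Submodule A L where
  carrier := {f | f ≠ 0 → ∀ P : HeightOnePrime A, 0 ≤ (ordAt P f : ℚ) + D P}
  zero_mem' h := absurd rfl h
  add_mem' {f g} hf hg hfg P := by
    have key : ∀ {x : L}, (x ≠ 0 → ∀ P : HeightOnePrime A, 0 ≤ (ordAt P x : ℚ) + D P) →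
        valuationAt L P x ≤ WithZero.exp ⌊D P⌋ := fun {x} hx => by
      by_cases h0 : x = 0
      · simp [h0]
      · exact (ordAt_nonneg_iff P h0 _).mp (hx h0 P)
    exact (ordAt_nonneg_iff P hfg _).mpr (Valuation.map_add_le _ (key hf) (key hg))
  smul_mem' a f hf haf P := by
    have hf0 : f ≠ 0 := fun h => haf (by simp [h])
    rw [ordAt_nonneg_iff P haf, Algebra.smul_def, map_mul]
    have h1 : valuationAt L P (algebraMap A L a) ≤ 1 := by
      rw [IsScalarTower.algebraMap_apply A (localRingAt L P) L]
      exact IsDedekindDomain.HeightOneSpectrum.valuation_le_one _ _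
    calc _ ≤ 1 * WithZero.exp ⌊D P⌋ :=
          mul_le_mul' h1 ((ordAt_nonneg_iff P hf0 _).mp (hf hf0 P))
      _ = _ := one_mul _

/-- The ideal `A ∩ A(D)` of `A`; this is `A(D)` itself as soon as `-D` is effective. -/
def divisorialIdeal (D : WeilDivisor A ℚ) : Ideal A :=
  (divisorialModule L D).comap (Algebra.linearMap A L)

variable {L} in
theorem mem_divisorialModule_iff {D : WeilDivisor A ℚ} {f : L} :
    f ∈ divisorialModule L D ↔ ∀ P, valuationAt L P f ≤ WithZero.exp ⌊D P⌋ := by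
  by_cases h0 : f = 0
  · subst h0; simp
  · exact ⟨fun h P => (ordAt_nonneg_iff P h0 _).mp (h h0 P),
      fun h _ P => (ordAt_nonneg_iff P h0 _).mpr (h P)⟩

/-- `A ⊆ A(D)` for an effective divisor `D`. -/
theorem algebraMap_mem_divisorialModule {D : WeilDivisor A ℚ} (hD : 0 ≤ D) (a : A) :
    algebraMap A L a ∈ divisorialModule L D := by
  rw [mem_divisorialModule_iff]
  intro P
  have h1 : valuationAt L P (algebraMap A L a) ≤ 1 := by
    rw [IsScalarTower.algebraMap_apply A (localRingAt L P) L]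
    exact IsDedekindDomain.HeightOneSpectrum.valuation_le_one _ _
  refine h1.trans ?_
  rw [← WithZero.exp_zero, WithZero.exp_le_exp]
  exact Int.floor_nonneg.mpr (hD P)

variable {L} in
/-- The `q`-th power of an element of `A(K)` lies in `A(qK + D)` if `D` is effective. -/
theorem pow_mem_divisorialModule {K : WeilDivisor A ℤ} {D : WeilDivisor A ℚ} (hD : 0 ≤ D)
    (q : ℕ) {f : L} (hf : f ∈ divisorialModule L K.toRat) :
    f ^ q ∈ divisorialModule L ((q : ℚ) • K.toRat + D) := by
  rw [mem_divisorialModule_iff] at hf ⊢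
  intro P
  have h1 := hf P
  have h2 : K.toRat P = (K P : ℚ) := by simp [WeilDivisor.toRat]
  rw [h2, Int.floor_intCast] at h1
  rw [map_pow]
  refine (pow_le_pow_left' h1 q).trans ?_
  rw [← WithZero.exp_nsmul, WithZero.exp_le_exp, Int.le_floor, Finsupp.add_apply,
    Finsupp.smul_apply, h2]
  have := hD P
  simp only [Finsupp.coe_zero, Pi.zero_apply] at this
  simp
  exact this

end Divisorial

/-- `(q - 1)Δ` for `q = p ^ e`. -/
def qSubOne {A : Type*} [CommRing A] (p e : ℕ) (Δ : WeilDivisor A ℚ) : WeilDivisor A ℚ := ((p : ℚ) ^ e - 1) • Δ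

theorem qSubOne_nonneg {A : Type*} [CommRing A] (p : ℕ) [Fact p.Prime] (e : ℕ)
    {Δ : WeilDivisor A ℚ} (hΔ : 0 ≤ Δ) : 0 ≤ qSubOne p e Δ := by
  intro P
  have h1 : (1 : ℚ) ≤ (p : ℚ) ^ e :=
    one_le_pow₀ (by exact_mod_cast (Fact.out : p.Prime).one_le)
  have := hΔ P
  simp only [Finsupp.coe_zero, Pi.zero_apply] at this
  simpa [qSubOne] using mul_nonneg (sub_nonneg.mpr h1) this

/-! ### F-purity and F-regularity of pairs -/

section Pairs


variable {A : Type u} [CommRing A] [IsDomain A] [IsNoetherianRing A] [IsIntegrallyClosed A]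
variable (p : ℕ) [Fact p.Prime] [CharP A p]
variable (L : Type u) [Field L] [Algebra A L] [IsFractionRing A L]

/-- `A` is F-finite: the Frobenius endomorphism is a finite ring map. -/
def IsFFinite (A : Type*) [CommRing A] (p : ℕ) [Fact p.Prime] [CharP A p] : Prop :=
  (frobenius A p).Finite

/-- The functor `M ↦ M^{1/q}`, `q = p ^ e`: the module `M` on which `a ∈ A` acts as
multiplication by `a ^ q`. -/
abbrev frobeniusRoot (A : Type u) [CommRing A] (p : ℕ) [Fact p.Prime] [CharP A p] (e : ℕ) :
    ModuleCat.{u} A ⥤ ModuleCat.{u} A :=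
  ModuleCat.restrictScalars (iterateFrobenius A p e)

/-- Multiplication by `c^{1/q}` on `M^{1/q}`, that is, multiplication by `c` on `M`. -/
def rootMul (e : ℕ) (c : A) (M : ModuleCat.{u} A) :
    (frobeniusRoot A p e).obj M ⟶ (frobeniusRoot A p e).obj M :=
  (frobeniusRoot A p e).map (ModuleCat.ofHom (LinearMap.lsmul A M c))

/-- The `e`-th Frobenius `A(K) → A(qK + D)`, `f ↦ f ^ q`, with `q = p ^ e`, `K` integral and `D`
effective, as a map semilinear over the `e`-th Frobenius of `A`. -/
def frobeniusSemilinear (e : ℕ) (K : WeilDivisor A ℤ) {D : WeilDivisor A ℚ} (hD : 0 ≤ D) :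
    divisorialModule L K.toRat →ₛₗ[iterateFrobenius A p e]
      divisorialModule L (((p ^ e : ℕ) : ℚ) • K.toRat + D) where
  toFun f := ⟨(f : L) ^ p ^ e, pow_mem_divisorialModule hD _ f.2⟩
  map_add' f g := Subtype.ext <| by
    have : CharP L p := charP_of_injective_algebraMap (IsFractionRing.injective A L) p
    simp [add_pow_char_pow]
  map_smul' a f := Subtype.ext <| by
    simp [Algebra.smul_def, mul_pow, iterateFrobenius_def]

/-- The inclusion `A ↪ A(D)^{1/q}`, with `q = p ^ e` and `D` effective, i.e. the `e`-th Frobenius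
`A → A(D)`, `a ↦ a ^ q`, as a map semilinear over the `e`-th Frobenius of `A`. -/
def inclusionSemilinear (e : ℕ) {D : WeilDivisor A ℚ} (hD : 0 ≤ D) :
    A →ₛₗ[iterateFrobenius A p e] divisorialModule L D where
  toFun a := ⟨algebraMap A L (a ^ p ^ e), algebraMap_mem_divisorialModule L hD _⟩
  map_add' a b := Subtype.ext <| by simp [add_pow_char_pow]
  map_smul' a b := Subtype.ext <| by
    simp [Algebra.smul_def, mul_pow, iterateFrobenius_def]

/-- The inclusion `A ↪ A(D)^{1/q}` as an `A`-linear map. -/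
def inclusionRoot (e : ℕ) {D : WeilDivisor A ℚ} (hD : 0 ≤ D) :
    ModuleCat.of A A ⟶ (frobeniusRoot A p e).obj (ModuleCat.of A (divisorialModule L D)) :=
  ModuleCat.semilinearMapAddEquiv (iterateFrobenius A p e) (ModuleCat.of A A)
    (ModuleCat.of A (divisorialModule L D)) (inclusionSemilinear p L e hD)

/-- `c^{1/q}A ↪ A(D)^{1/q}` splits as a map of `A`-modules, where `q = p ^ e`. For `c ≠ 0` the
module `c^{1/q}A` is free on `c^{1/q}`, and the inclusion is written as the map
`A → A(D)^{1/q}`, `1 ↦ c^{1/q}`. -/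
def SplitsAt (e : ℕ) (c : A) {D : WeilDivisor A ℚ} (hD : 0 ≤ D) : Prop :=
  IsSplitMono (inclusionRoot p L e hD ≫ rootMul p e c (ModuleCat.of A (divisorialModule L D)))

/-- The pair `(A, Δ)` is F-pure: `A ↪ A((q-1)Δ)^{1/q}` splits for every `q = p ^ e`. -/
def IsFPurePair {Δ : WeilDivisor A ℚ} (hΔ : 0 ≤ Δ) : Prop :=
  ∀ e : ℕ, 1 ≤ e → IsSplitMono (inclusionRoot p L e (qSubOne_nonneg p e hΔ))

/-- The pair `(A, Δ)` is strongly F-regular: for every `c ≠ 0` there is `q = p ^ e` such that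
`c^{1/q}A ↪ A((q-1)Δ)^{1/q}` splits. -/
def IsStronglyFRegularPair {Δ : WeilDivisor A ℚ} (hΔ : 0 ≤ Δ) : Prop :=
  ∀ c : A, c ≠ 0 → ∃ e : ℕ, 1 ≤ e ∧ SplitsAt p L e c (qSubOne_nonneg p e hΔ)

/-- `c` is nonzero and lies in no minimal prime of the ideal `A(-⌊Δ⌋)` of `A`. -/
def IsAdmissible (Δ : WeilDivisor A ℚ) (c : A) : Prop :=
  c ≠ 0 ∧ ∀ Q ∈ (divisorialIdeal L (-Δ.floor)).minimalPrimes, c ∉ Q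

/-- The pair `(A, Δ)` is divisorially F-regular: for every `c ≠ 0` in no minimal prime of
`A(-⌊Δ⌋)` there is `q = p ^ e` such that `c^{1/q}A ↪ A((q-1)Δ)^{1/q}` splits. -/
def IsDivisoriallyFRegularPair {Δ : WeilDivisor A ℚ} (hΔ : 0 ≤ Δ) : Prop :=
  ∀ c : A, IsAdmissible L Δ c → ∃ e : ℕ, 1 ≤ e ∧ SplitsAt p L e c (qSubOne_nonneg p e hΔ)

end Pairs

/-! ### Canonical divisors and Frobenius on local cohomology -/

section LocalCohomology


variable {A : Type u} [CommRing A] [IsLocalRing A]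

/-- `E` is an injective envelope of the residue field of the local ring `A`. -/
def IsInjectiveEnvelopeOfResidueField (A : Type u) [CommRing A] [IsLocalRing A]
    (E : Type u) [AddCommGroup E] [Module A E] : Prop :=
  Module.Injective A E ∧
    ∃ i : IsLocalRing.ResidueField A →ₗ[A] E, Function.Injective i ∧
      ∀ N : Submodule A E, N ⊓ LinearMap.range i = ⊥ → N = ⊥

/-- The local cohomology functor `H^i_𝔪` with support in the maximal ideal of `A`. -/
abbrev localCohomologyAtMax (A : Type u) [CommRing A] [IsLocalRing A] (i : ℕ) :
    ModuleCat.{u} A ⥤ ModuleCat.{u} A :=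
  localCohomology (IsLocalRing.maximalIdeal A) i

/-- `ω` is a canonical module of the `d`-dimensional local ring `A`: it is finitely generated and
its Matlis dual `Hom_A(ω, E)` is isomorphic to `H^d_𝔪(A)`, where `E` is an injective envelope of
the residue field. -/
def IsCanonicalModule (d : ℕ) (ω : Type u) [AddCommGroup ω] [Module A ω] : Prop :=
  Module.Finite A ω ∧
    ∃ (E : Type u) (_ : AddCommGroup E) (_ : Module A E),
      IsInjectiveEnvelopeOfResidueField A E ∧
        Nonempty ((ω →ₗ[A] E) ≃ₗ[A] (localCohomologyAtMax A d).obj (ModuleCat.of A A))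

variable [IsDomain A] [IsNoetherianRing A] [IsIntegrallyClosed A]
variable (p : ℕ) [Fact p.Prime] [CharP A p]
variable (L : Type u) [Field L] [Algebra A L] [IsFractionRing A L]

/-- `K` is a canonical divisor `K_A` of the `d`-dimensional normal local ring `A`: an integral Weil
divisor such that `A(K)` is a canonical module of `A`. -/
def IsCanonicalDivisor (d : ℕ) (K : WeilDivisor A ℤ) : Prop :=
  IsCanonicalModule (A := A) d (divisorialModule L K.toRat)

/-- The module `A(qK + (q-1)Δ)`, where `q = p ^ e`. -/
abbrev twistedModule (e : ℕ) (K : WeilDivisor A ℤ) (Δ : WeilDivisor A ℚ) : ModuleCat.{u} A :=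
  ModuleCat.of A (divisorialModule L (((p ^ e : ℕ) : ℚ) • K.toRat + qSubOne p e Δ))

/-- The `A`-linear map `A(K) → A(qK + (q-1)Δ)^{1/q}` given by the `e`-th Frobenius `f ↦ f ^ q`. -/
def frobeniusRootMap (e : ℕ) (K : WeilDivisor A ℤ) {Δ : WeilDivisor A ℚ} (hΔ : 0 ≤ Δ) :
    ModuleCat.of A (divisorialModule L K.toRat) ⟶
      (frobeniusRoot A p e).obj (twistedModule p L e K Δ) :=
  ModuleCat.semilinearMapAddEquiv (iterateFrobenius A p e)
    (ModuleCat.of A (divisorialModule L K.toRat)) (twistedModule p L e K Δ)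
    (frobeniusSemilinear p L e K (qSubOne_nonneg p e hΔ))

/-- The induced `e`-th Frobenius `F^e : H^d_𝔪(A(K)) → H^d_𝔪(A(qK + (q-1)Δ))`. As `F^e` is
semilinear over the Frobenius of `A`, its target is written as the `A`-module
`H^d_𝔪(A(qK + (q-1)Δ)^{1/q}) = H^d_𝔪(A(qK + (q-1)Δ))^{1/q}`. -/
def frobeniusLC (d e : ℕ) (K : WeilDivisor A ℤ) {Δ : WeilDivisor A ℚ} (hΔ : 0 ≤ Δ) :
    (localCohomologyAtMax A d).obj (ModuleCat.of A (divisorialModule L K.toRat)) ⟶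
      (localCohomologyAtMax A d).obj ((frobeniusRoot A p e).obj (twistedModule p L e K Δ)) :=
  (localCohomologyAtMax A d).map (frobeniusRootMap p L e K hΔ)

/-- The map `cF^e : H^d_𝔪(A(K)) → H^d_𝔪(A(qK + (q-1)Δ))`: the `e`-th Frobenius followed by the
map induced by multiplication by `c` on `A(qK + (q-1)Δ)`. -/
def mulFrobeniusLC (d e : ℕ) (c : A) (K : WeilDivisor A ℤ) {Δ : WeilDivisor A ℚ} (hΔ : 0 ≤ Δ) :
    (localCohomologyAtMax A d).obj (ModuleCat.of A (divisorialModule L K.toRat)) ⟶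
      (localCohomologyAtMax A d).obj ((frobeniusRoot A p e).obj (twistedModule p L e K Δ)) :=
  frobeniusLC p L d e K hΔ ≫
    (localCohomologyAtMax A d).map (rootMul p e c (twistedModule p L e K Δ))

end LocalCohomology

end

/-! All three equivalences hold one `q` and one `c` at a time: `cF^e` is injective on `H^d_𝔪(K_A)`
exactly when `ι_{c,q}` splits (`injective_mulFrobeniusLC_iff_splitsAt`). Two facts carry this.

Duality. For `ω = A(K_A)`, a map `f : ω → N` with `N` finitely generated splits if and only if
`H^d_𝔪(f)` is injective (`IsCanonicalModule.map_injective_iff`). On finitely generated modules both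
`H^d_𝔪` and `Hom(Hom(-, ω), E)` are linear and right exact, so each is `- ⊗` its value at `A`, and
these values are isomorphic because `ω` is canonical. Injectivity of `H^d_𝔪(f)` therefore makes
`Hom(N, ω) → Hom(ω, ω)` surjective, since `E` detects nonzero elements, and a preimage of the
identity is a retraction. Right exactness of `H^d_𝔪` is Grothendieck vanishing in degree `d + 1`,
proved on the directed system `Ext(A/𝔪^t, M)`. F-finiteness makes `N = A(qK + (q-1)Δ)^{1/q}`
finitely generated.

Twisting. Whether `A(K) → A(qK + D)^{1/q}`, `f ↦ (c f^q)^{1/q}`, has a retraction does not depend on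
the integral divisor `K` (`HasFrobeniusRetraction.twist`): from a retraction `φ` for `K₁` the
formula `x ↦ t⁻¹ φ(t^q x)`, `t ∈ A(K₁ - K₂)`, gives one for `K₂`. The value `K = K_A` is the local
cohomology side and `K = 0` is the definition of splitting. -/

noncomputable section

open Limits Opposite
open scoped TensorProduct

/-! ### Cocycles representing the derived-functor `Ext` -/

namespace CategoryTheory.ProjectiveResolution

universe v w t
variable (R : Type t) [Ring R] {C : Type w} [Category.{v} C] [Abelian C] [Linear R C]
  {X : C} (P : ProjectiveResolution X) (n : ℕ) (Y : C)

/-- The cocycles of degree `n` in `Hom(P, Y)` for a projective resolution `P`. -/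
def extCocycles : Submodule R (P.complex.X n ⟶ Y) :=
  LinearMap.ker (Linear.leftComp R Y (P.complex.d (n + 1) n))

variable {R P n Y} in
theorem mem_extCocycles {f : P.complex.X n ⟶ Y} :
    f ∈ P.extCocycles R n Y ↔ P.complex.d (n + 1) n ≫ f = 0 := Iff.rfl

/-- The functor `Hom(-, Y)` whose derived functor defines `Ext R C n`. -/
abbrev homOp : C ⥤ (ModuleCat.{v} R)ᵒᵖ := ((linearYoneda R C).obj Y).rightOp

abbrev homComplex : ChainComplex (ModuleCat.{v} R)ᵒᵖ ℕ :=
  ((homOp R Y).mapHomologicalComplex _).obj P.complex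

/-- Cocycles as a map out of the opcycles of the opposite complex. -/
def descCocycles : (P.homComplex R Y).opcycles n ⟶ op (ModuleCat.of R (P.extCocycles R n Y)) :=
  HomologicalComplex.descOpcycles _ (ModuleCat.ofHom (P.extCocycles R n Y).subtype).op (n + 1)
    (by simp) (by
      apply Quiver.Hom.unop_inj
      ext f
      exact f.2)

theorem pOpcycles_descCocycles :
    (P.homComplex R Y).pOpcycles n ≫ P.descCocycles R n Y =
      (ModuleCat.ofHom (P.extCocycles R n Y).subtype).op :=
  HomologicalComplex.p_descOpcycles ..

theorem pOpcycles_unop_injective :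
    Function.Injective ((P.homComplex R Y).pOpcycles n).unop := by
  rw [← ModuleCat.mono_iff_injective]
  infer_instance

theorem descCocycles_unop_apply (z : P.extCocycles R n Y) :
    ((P.homComplex R Y).pOpcycles n).unop ((P.descCocycles R n Y).unop z) = z.1 := by
  have := congr($(P.pOpcycles_descCocycles R n Y).unop z)
  exact this

theorem descCocycles_unop_surjective :
    Function.Surjective (P.descCocycles R n Y).unop := by
  intro y
  have hf : P.complex.d (n + 1) n ≫ (((P.homComplex R Y).pOpcycles n).unop y) = 0 := by
    have := congr($((P.homComplex R Y).d_pOpcycles (n + 1) n).unop y)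
    exact this
  refine ⟨⟨_, hf⟩, ?_⟩
  apply P.pOpcycles_unop_injective R n Y
  exact P.descCocycles_unop_apply R n Y ⟨_, hf⟩

variable [EnoughProjectives C]

/-- The derived functor defining `Ext`, computed by the projective resolution `P`. -/
def isoLeftDerived : ((homOp R Y).leftDerived n).obj X ≅ (P.homComplex R Y).homology n :=
  P.isoLeftDerivedObj (homOp R Y) n

/-- The class map of cocycles, in the opposite category. -/
def toOpCocycles :
    ((homOp R Y).leftDerived n).obj X ⟶ op (ModuleCat.of R (P.extCocycles R n Y)) :=
  (P.isoLeftDerived R n Y).hom ≫ (P.homComplex R Y).homologyι n ≫ P.descCocycles R n Y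

/-- The class in `Ext` of a cocycle. -/
def cocycleToExt :
    ModuleCat.of R (P.extCocycles R n Y) ⟶ ((Ext R C n).obj (op X)).obj Y :=
  (P.toOpCocycles R n Y).unop

theorem cocycleToExt_surjective : Function.Surjective (P.cocycleToExt R n Y) := by
  have h1 : Function.Surjective (P.isoLeftDerived R n Y).hom.unop := by
    rw [← ModuleCat.epi_iff_surjective]; infer_instance
  have h2 : Function.Surjective ((P.homComplex R Y).homologyι n).unop := by
    rw [← ModuleCat.epi_iff_surjective]; infer_instance
  exact h1.comp (h2.comp (P.descCocycles_unop_surjective R n Y))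

/-- Homology is the kernel of opcycles → next term in the opposite category; read backwards, this
says that the kernel of the class map is the coboundaries. Indexing by `next n` includes degree
zero, where `next 0 = 0` and the differential is zero. -/
theorem cocycleToExt_eq_zero_iff (z : P.extCocycles R n Y) :
    P.cocycleToExt R n Y z = 0 ↔
      ∃ g : P.complex.X ((ComplexShape.down ℕ).next n) ⟶ Y,
        P.complex.d n ((ComplexShape.down ℕ).next n) ≫ g = z.1 := by
  have h1 : Function.Injective (P.isoLeftDerived R n Y).hom.unop := by
    rw [← ModuleCat.mono_iff_injective]; infer_instance
  have key : P.cocycleToExt R n Y z = 0 ↔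
      ((P.homComplex R Y).homologyι n).unop ((P.descCocycles R n Y).unop z) = 0 :=
    map_eq_zero_iff (P.isoLeftDerived R n Y).hom.unop.hom h1
  have hex : (ShortComplex.mk ((P.homComplex R Y).homologyι n)
      ((P.homComplex R Y).fromOpcycles n ((ComplexShape.down ℕ).next n)) (by simp)).Exact :=
    ShortComplex.exact_of_f_is_kernel _ (HomologicalComplex.homologyIsKernel _ _ _ rfl)
  have hex' : ∀ y, ((P.homComplex R Y).homologyι n).unop y = 0 →
      ∃ g : P.complex.X ((ComplexShape.down ℕ).next n) ⟶ Y,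
        ((P.homComplex R Y).fromOpcycles n ((ComplexShape.down ℕ).next n)).unop g = y :=
    (ShortComplex.moduleCat_exact_iff _).mp hex.unop
  have hzero (g : P.complex.X ((ComplexShape.down ℕ).next n) ⟶ Y) :
      ((P.homComplex R Y).homologyι n).unop
        (((P.homComplex R Y).fromOpcycles n ((ComplexShape.down ℕ).next n)).unop g) = 0 := by
    have := congr($((P.homComplex R Y).homologyι_comp_fromOpcycles n
      ((ComplexShape.down ℕ).next n)).unop g)
    exact this
  have hd (g : P.complex.X ((ComplexShape.down ℕ).next n) ⟶ Y) :
      ((P.homComplex R Y).pOpcycles n).unop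
        (((P.homComplex R Y).fromOpcycles n ((ComplexShape.down ℕ).next n)).unop g) =
        P.complex.d n ((ComplexShape.down ℕ).next n) ≫ g := by
    have := congr($((P.homComplex R Y).p_fromOpcycles n ((ComplexShape.down ℕ).next n)).unop g)
    exact this
  rw [key]
  constructor
  · intro h
    obtain ⟨g, hg⟩ := hex' _ h
    refine ⟨g, ?_⟩
    rw [← hd, ← P.descCocycles_unop_apply R n Y z]
    exact congr(((P.homComplex R Y).pOpcycles n).unop $hg)
  · rintro ⟨g, hg⟩
    rw [← hd, ← P.descCocycles_unop_apply R n Y z] at hg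
    rw [← P.pOpcycles_unop_injective R n Y hg]
    exact hzero g

/-- Postcomposition on cocycles. -/
def extCocyclesMap {Y' : C} (f : Y ⟶ Y') : P.extCocycles R n Y →ₗ[R] P.extCocycles R n Y' :=
  (Linear.rightComp R _ f).restrict fun z hz => by
    rw [mem_extCocycles] at hz ⊢
    simp [reassoc_of% hz]

/-- Precomposition on cocycles. -/
def extCocyclesComap {X' : C} {f : X' ⟶ X} {P' : ProjectiveResolution X'}
    (φ : Hom P' P f) : P.extCocycles R n Y →ₗ[R] P'.extCocycles R n Y :=
  (Linear.leftComp R _ (φ.hom.f n)).restrict fun z hz => by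
    rw [mem_extCocycles] at hz ⊢
    simp only [Linear.leftComp_apply]
    rw [← φ.hom.comm_assoc, hz, comp_zero]

theorem cocycleToExt_map_right {Y' : C} (f : Y ⟶ Y') (z : P.extCocycles R n Y) :
    ((Ext R C n).obj (op X)).map f (P.cocycleToExt R n Y z) =
      P.cocycleToExt R n Y' (P.extCocyclesMap R n Y f z) := by
  let α : homOp R Y' ⟶ homOp R Y := NatTrans.rightOp ((linearYoneda R C).map f)
  let β : P.homComplex R Y' ⟶ P.homComplex R Y :=
    (NatTrans.mapHomologicalComplex α _).app P.complex
  have h2 : HomologicalComplex.opcyclesMap β n ≫ P.descCocycles R n Y =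
      P.descCocycles R n Y' ≫ (ModuleCat.ofHom (P.extCocyclesMap R n Y f)).op := by
    rw [← cancel_epi ((P.homComplex R Y').pOpcycles n), ← Category.assoc, ← Category.assoc,
      pOpcycles_descCocycles, HomologicalComplex.p_opcyclesMap, Category.assoc,
      pOpcycles_descCocycles]
    rfl
  have h3 : (NatTrans.leftDerived α n).app X ≫ P.toOpCocycles R n Y =
      P.toOpCocycles R n Y' ≫ (ModuleCat.ofHom (P.extCocyclesMap R n Y f)).op := by
    have h4 : (NatTrans.leftDerived α n).app X = (P.isoLeftDerived R n Y').hom ≫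
        HomologicalComplex.homologyMap β n ≫ (P.isoLeftDerived R n Y).inv :=
      P.leftDerived_app_eq α n
    rw [h4, toOpCocycles, toOpCocycles]
    simp only [Category.assoc, Iso.inv_hom_id_assoc]
    rw [HomologicalComplex.homologyι_naturality_assoc, h2]
  exact congr(($h3).unop z)

theorem cocycleToExt_map_left {X' : C} (f : X' ⟶ X) (P' : ProjectiveResolution X')
    (φ : Hom P' P f) (z : P.extCocycles R n Y) :
    ((Ext R C n).map f.op).app Y (P.cocycleToExt R n Y z) =
      P'.cocycleToExt R n Y (P.extCocyclesComap R n Y φ z) := by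
  let β : P'.homComplex R Y ⟶ P.homComplex R Y :=
    ((homOp R Y).mapHomologicalComplex _).map φ.hom
  have h2 : HomologicalComplex.opcyclesMap β n ≫ P.descCocycles R n Y =
      P'.descCocycles R n Y ≫ (ModuleCat.ofHom (P.extCocyclesComap R n Y φ)).op := by
    rw [← cancel_epi ((P'.homComplex R Y).pOpcycles n), ← Category.assoc, ← Category.assoc,
      pOpcycles_descCocycles, HomologicalComplex.p_opcyclesMap, Category.assoc,
      pOpcycles_descCocycles]
    rfl
  have h3 : ((homOp R Y).leftDerived n).map f ≫ P.toOpCocycles R n Y =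
      P'.toOpCocycles R n Y ≫ (ModuleCat.ofHom (P.extCocyclesComap R n Y φ)).op := by
    have h4 : ((homOp R Y).leftDerived n).map f ≫ (P.isoLeftDerived R n Y).hom =
        (P'.isoLeftDerived R n Y).hom ≫ HomologicalComplex.homologyMap β n :=
      P'.isoLeftDerivedObj_hom_naturality f P φ.hom (by simpa using φ.hom_f_zero_comp_π_f_zero) (homOp R Y) n
    rw [toOpCocycles, toOpCocycles, reassoc_of% h4,
      HomologicalComplex.homologyι_naturality_assoc, h2]
    simp only [Category.assoc]
  exact congr(($h3).unop z)

end CategoryTheory.ProjectiveResolution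

/-! ### The same cocycles representing `Abelian.Ext` -/

namespace CategoryTheory.ProjectiveResolution

universe v w t w'

section

variable {C : Type w} [Category.{v} C] [Abelian C] [HasExt.{w'} C] {X Y : C}
  (P : ProjectiveResolution X)

theorem extMk_eq_zero_iff_next (n : ℕ) (f : P.complex.X n ⟶ Y)
    (hf : P.complex.d (n + 1) n ≫ f = 0) :
    P.extMk f (n + 1) rfl hf = 0 ↔
      ∃ g : P.complex.X ((ComplexShape.down ℕ).next n) ⟶ Y,
        P.complex.d n ((ComplexShape.down ℕ).next n) ≫ g = f := by
  rcases n with - | p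
  · have h0 : P.complex.d 0 ((ComplexShape.down ℕ).next 0) = 0 :=
      P.complex.shape _ _ (by simp [ChainComplex.next_nat_zero])
    simp only [h0, zero_comp, exists_const_iff]
    simp only [← P.extEquivCohomologyClass.apply_eq_iff_eq,
      extEquivCohomologyClass_extMk, extEquivCohomologyClass_zero,
      CochainComplex.HomComplex.CohomologyClass.mk_eq_zero_iff]
    rw [CochainComplex.HomComplex.Cocycle.toSingleMk_mem_coboundaries_iff _ _ _ _ _ 1 (by simp)]
    -- In degree zero there are no nonzero coboundaries, since the cochain complex of a resolution
    -- lives in nonpositive degrees.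
    have hz : IsZero (P.cochainComplex.X 1) :=
      CochainComplex.isZero_of_isStrictlyLE _ 0 _ (by simp)
    constructor
    · rintro ⟨g, hg⟩
      refine ⟨⟨0⟩, ?_⟩
      rw [hz.eq_of_src g 0, comp_zero] at hg
      rw [← cancel_epi (P.cochainComplexXIso (-(0 : ℕ)) 0 rfl).hom, ← hg, comp_zero]
    · rintro ⟨-, hg⟩
      exact ⟨0, by rw [← hg]; simp⟩
  · rw [ChainComplex.next_nat_succ, P.extMk_eq_zero_iff f _ rfl hf p rfl]

end

variable (R : Type t) [Ring R] {C : Type w} [Category.{v} C] [Abelian C] [Linear R C]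
  {X : C} (P : ProjectiveResolution X) (n : ℕ) (Y : C) [HasExt.{w'} C]

/-- The class map of cocycles with values in `Abelian.Ext`. -/
def cocycleToAbelianExt : P.extCocycles R n Y →ₗ[R] Abelian.Ext X Y n where
  toFun z := P.extMk z.1 (n + 1) rfl z.2
  map_add' z z' := (P.add_extMk ..).symm
  map_smul' r z := by
    have h : P.extMk z.1 (n + 1) rfl z.2 = P.extMk z.1 (n + 1) rfl (mem_extCocycles.mp z.2) := rfl
    rw [Abelian.Ext.smul_eq_comp_mk₀, h, P.extMk_comp_mk₀]
    congr 1
    simp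

theorem cocycleToAbelianExt_surjective : Function.Surjective (P.cocycleToAbelianExt R n Y) := by
  intro α
  obtain ⟨f, hf, h⟩ := P.extMk_surjective α (n + 1) rfl
  exact ⟨⟨f, hf⟩, h⟩

theorem cocycleToAbelianExt_map_right {Y' : C} (f : Y ⟶ Y') (z : P.extCocycles R n Y) :
    (P.cocycleToAbelianExt R n Y z).comp (Abelian.Ext.mk₀ f) (add_zero n) =
      P.cocycleToAbelianExt R n Y' (P.extCocyclesMap R n Y f z) :=
  P.extMk_comp_mk₀ z.1 (n + 1) rfl z.2 f

theorem cocycleToAbelianExt_map_left {X' : C} (f : X' ⟶ X) (P' : ProjectiveResolution X')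
    (φ : Hom P' P f) (z : P.extCocycles R n Y) :
    (Abelian.Ext.mk₀ f).comp (P.cocycleToAbelianExt R n Y z) (zero_add n) =
      P'.cocycleToAbelianExt R n Y (P.extCocyclesComap R n Y φ z) :=
  mk₀_comp_extMk z.1 (n + 1) rfl z.2 φ

variable [EnoughProjectives C]

/-- Both class maps kill exactly the coboundaries, so both `Ext` groups are the same quotient of the
cocycles. The long exact sequences of `Abelian.Ext` thereby become available for local cohomology.
-/
theorem ker_cocycleToAbelianExt :
    LinearMap.ker (P.cocycleToAbelianExt R n Y) = LinearMap.ker (P.cocycleToExt R n Y).hom := by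
  ext z
  exact (P.extMk_eq_zero_iff_next n z.1 z.2).trans (P.cocycleToExt_eq_zero_iff R n Y z).symm

end CategoryTheory.ProjectiveResolution

/-! ### Comparison of the two `Ext` modules, natural in both variables -/

namespace CategoryTheory

universe v w t w'

variable (R : Type t) [Ring R] {C : Type w} [Category.{v} C] [Abelian C] [Linear R C]
  [HasExt.{w'} C] [EnoughProjectives C]

/-- The two definitions of the `Ext` modules agree. -/
def abelianExtEquiv (X Y : C) (n : ℕ) :
    Abelian.Ext X Y n ≃ₗ[R] ((Ext R C n).obj (op X)).obj Y :=
  let P := projectiveResolution X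
  ((P.cocycleToAbelianExt R n Y).quotKerEquivOfSurjective
    (P.cocycleToAbelianExt_surjective R n Y)).symm ≪≫ₗ
  Submodule.quotEquivOfEq _ _ (P.ker_cocycleToAbelianExt R n Y) ≪≫ₗ
  (P.cocycleToExt R n Y).hom.quotKerEquivOfSurjective (P.cocycleToExt_surjective R n Y)

theorem abelianExtEquiv_apply (X Y : C) (n : ℕ)
    (z : (projectiveResolution X).extCocycles R n Y) :
    abelianExtEquiv R X Y n ((projectiveResolution X).cocycleToAbelianExt R n Y z) =
      (projectiveResolution X).cocycleToExt R n Y z := by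
  have h : ((projectiveResolution X).cocycleToAbelianExt R n Y).quotKerEquivOfSurjective
      ((projectiveResolution X).cocycleToAbelianExt_surjective R n Y) (Submodule.Quotient.mk z) =
      (projectiveResolution X).cocycleToAbelianExt R n Y z := rfl
  rw [← h]
  simp only [abelianExtEquiv, LinearEquiv.trans_apply, LinearEquiv.symm_apply_apply]
  rfl

theorem abelianExtEquiv_comp (X : C) {Y Y' : C} (n : ℕ) (f : Y ⟶ Y') (α : Abelian.Ext X Y n) :
    abelianExtEquiv R X Y' n (α.comp (Abelian.Ext.mk₀ f) (add_zero n)) =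
      ((Ext R C n).obj (op X)).map f (abelianExtEquiv R X Y n α) := by
  obtain ⟨z, rfl⟩ := (projectiveResolution X).cocycleToAbelianExt_surjective R n Y α
  rw [ProjectiveResolution.cocycleToAbelianExt_map_right, abelianExtEquiv_apply,
    abelianExtEquiv_apply, ProjectiveResolution.cocycleToExt_map_right]

theorem abelianExtEquiv_precomp {X X' : C} (Y : C) (n : ℕ) (f : X' ⟶ X)
    (α : Abelian.Ext X Y n) :
    abelianExtEquiv R X' Y n ((Abelian.Ext.mk₀ f).comp α (zero_add n)) =
      ((Ext R C n).map f.op).app Y (abelianExtEquiv R X Y n α) := by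
  obtain ⟨z, rfl⟩ := (projectiveResolution X).cocycleToAbelianExt_surjective R n Y α
  let φ : (projectiveResolution X').Hom (projectiveResolution X) f :=
    { hom := ProjectiveResolution.lift f _ _
      hom_f_zero_comp_π_f_zero := by
        have := congr(($(ProjectiveResolution.lift_commutes f (projectiveResolution X')
          (projectiveResolution X))).f 0)
        exact this }
  rw [ProjectiveResolution.cocycleToAbelianExt_map_left R _ n Y f _ φ, abelianExtEquiv_apply,
    abelianExtEquiv_apply, ProjectiveResolution.cocycleToExt_map_left R _ n Y f _ φ]

end CategoryTheory

/-! ### Local cohomology as the directed union of images of `Ext(A/J^t, M)` -/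

namespace localCohomology

variable {A : Type u} [CommRing A] (J : Ideal A)

/-- The module `A ⧸ J ^ t`. -/
abbrev quotPow (t : ℕ) : ModuleCat.{u} A := ModuleCat.of A (A ⧸ J ^ t)

/-- The projection `A ⧸ J ^ s → A ⧸ J ^ t` for `t ≤ s`. -/
def quotPowMap {t s : ℕ} (h : t ≤ s) : quotPow J s ⟶ quotPow J t :=
  ModuleCat.ofHom (Submodule.mapQ _ _ LinearMap.id (Ideal.pow_le_pow_right h))

variable {J} in
/-- The transition map of the directed system `Ext (A ⧸ J ^ t) M i`. -/
def restr {M : ModuleCat.{u} A} {i t s : ℕ} (h : t ≤ s) (x : Abelian.Ext (quotPow J t) M i) :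
    Abelian.Ext (quotPow J s) M i :=
  (Abelian.Ext.mk₀ (quotPowMap J h)).comp x (zero_add i)

variable (M : ModuleCat.{u} A) (i : ℕ)

/-- The colimit cocone computing local cohomology of `M`. -/
def coconeAt : Cocone (diagram (idealPowersDiagram J) i ⋙ (evaluation _ _).obj M) :=
  ((evaluation _ _).obj M).mapCocone (colimit.cocone (diagram (idealPowersDiagram J) i))

def isColimitCoconeAt : IsColimit (coconeAt J M i) :=
  isColimitOfPreserves _ (colimit.isColimit _)

/-- The natural map from `Ext (A ⧸ J ^ t) M i` to local cohomology. -/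
def fromExt (t : ℕ) : Abelian.Ext (quotPow J t) M i →ₗ[A] (localCohomology J i).obj M :=
  ((coconeAt J M i).ι.app (op (op t))).hom ∘ₗ
    (abelianExtEquiv A (quotPow J t) M i).toLinearMap

/-- The index category is filtered and lives in universe `0`; this is what permits elementwise
arguments in the colimit. -/
instance : PreservesColimitsOfShape (ℕᵒᵖ)ᵒᵖ (forget (ModuleCat.{u} A)) :=
  have : PreservesFilteredColimitsOfSize.{0, 0} (forget (ModuleCat.{u} A)) :=
    preservesFilteredColimitsOfSize_shrink.{0, u, 0, u} _
  inferInstance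

/-- Together with `fromExt_eq_zero_iff`, `fromExt_restr` and `map_fromExt`, this is all that is used
later about the colimit. -/
theorem fromExt_jointly_surjective (y : (localCohomology J i).obj M) :
    ∃ t x, fromExt J M i t x = y := by
  obtain ⟨j, x, hx⟩ := Concrete.isColimit_exists_rep _ (isColimitCoconeAt J M i) y
  refine ⟨j.unop.unop, (abelianExtEquiv A (quotPow J j.unop.unop) M i).symm x, ?_⟩
  exact (congrArg (fun z => (coconeAt J M i).ι.app j z)
    (LinearEquiv.apply_symm_apply (abelianExtEquiv A (quotPow J j.unop.unop) M i) x)).trans hx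

theorem map_abelianExtEquiv {t s : ℕ} (h : t ≤ s) (x : Abelian.Ext (quotPow J t) M i) :
    (diagram (idealPowersDiagram J) i ⋙ (evaluation _ _).obj M).map (homOfLE h).op.op
      (abelianExtEquiv A (quotPow J t) M i x) =
      abelianExtEquiv A (quotPow J s) M i (restr h x) :=
  (abelianExtEquiv_precomp A M i (quotPowMap J h) x).symm

variable {M i} in
theorem fromExt_eq_zero_iff {t : ℕ} (x : Abelian.Ext (quotPow J t) M i) :
    fromExt J M i t x = 0 ↔ ∃ s, ∃ h : t ≤ s, restr h x = 0 := by
  have key := IsColimit.eq_iff' (isColimitCoconeAt J M i) (i := op (op t))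
    (abelianExtEquiv A (quotPow J t) M i x) (0 : ((diagram (idealPowersDiagram J) i ⋙
      (evaluation _ _).obj M).obj (op (op t))))
  have h0 : (coconeAt J M i).ι.app (op (op t)) (0 : ((diagram (idealPowersDiagram J) i ⋙
      (evaluation _ _).obj M).obj (op (op t)))) = 0 := map_zero _
  rw [h0] at key
  refine Iff.trans key ⟨?_, ?_⟩
  · rintro ⟨j, f, hf⟩
    refine ⟨j.unop.unop, leOfHom f.unop.unop, ?_⟩
    rw [map_zero] at hf
    rw [← (abelianExtEquiv A (quotPow J j.unop.unop) M i).map_eq_zero_iff,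
      ← map_abelianExtEquiv]
    exact hf
  · rintro ⟨s, h, hs⟩
    refine ⟨op (op s), (homOfLE h).op.op, ?_⟩
    rw [map_abelianExtEquiv, hs, map_zero, map_zero]
    rfl

theorem fromExt_restr {t s : ℕ} (h : t ≤ s) (x : Abelian.Ext (quotPow J t) M i) :
    fromExt J M i s (restr h x) = fromExt J M i t x := by
  have h1 := congr($((coconeAt J M i).w (homOfLE h).op.op)
    (abelianExtEquiv A (quotPow J t) M i x))
  exact (congrArg (fun z => (coconeAt J M i).ι.app (op (op s)) z)
    (map_abelianExtEquiv J M i h x)).symm.trans h1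

theorem map_fromExt {M N : ModuleCat.{u} A} (f : M ⟶ N) {i t : ℕ}
    (x : Abelian.Ext (quotPow J t) M i) :
    (localCohomology J i).map f (fromExt J M i t x) =
      fromExt J N i t (x.comp (Abelian.Ext.mk₀ f) (add_zero i)) := by
  have h1 := congr($(((colimit.cocone (diagram (idealPowersDiagram J) i)).ι.app
    (op (op t))).naturality f) (abelianExtEquiv A (quotPow J t) M i x))
  exact h1.symm.trans (congrArg (fun z => (coconeAt J N i).ι.app (op (op t)) z)
    (abelianExtEquiv_comp A (quotPow J t) i f x)).symm

end localCohomology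

/-! ### Power torsion and injective modules -/

namespace Module

variable {A : Type u} [CommRing A] (J : Ideal A)

/-- `M` is `J`-power torsion if each element is killed by a power of `J`. -/
def IsPowTorsion (M : Type*) [AddCommGroup M] [Module A M] : Prop :=
  ∀ m : M, ∃ n : ℕ, ∀ a ∈ J ^ n, a • m = 0

/-- The `J`-power torsion submodule. -/
def powTorsion (M : Type*) [AddCommGroup M] [Module A M] : Submodule A M where
  carrier := {m | ∃ n : ℕ, ∀ a ∈ J ^ n, a • m = 0}
  zero_mem' := ⟨0, by simp⟩
  add_mem' := by
    rintro m m' ⟨n, h⟩ ⟨n', h'⟩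
    refine ⟨max n n', fun a ha => ?_⟩
    rw [smul_add, h a (Ideal.pow_le_pow_right (le_max_left _ _) ha),
      h' a (Ideal.pow_le_pow_right (le_max_right _ _) ha), add_zero]
  smul_mem' := by
    rintro b m ⟨n, h⟩
    exact ⟨n, fun a ha => by rw [smul_comm, h a ha, smul_zero]⟩

variable {J}

theorem IsPowTorsion.of_surjective {M N : Type*} [AddCommGroup M] [Module A M] [AddCommGroup N]
    [Module A N] (hM : IsPowTorsion J M) (f : M →ₗ[A] N) (hf : Function.Surjective f) :
    IsPowTorsion J N := by
  intro y
  obtain ⟨x, rfl⟩ := hf y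
  obtain ⟨n, hn⟩ := hM x
  exact ⟨n, fun a ha => by rw [← map_smul, hn a ha, map_zero]⟩

variable (J) in
theorem isPowTorsion_powTorsion (M : Type*) [AddCommGroup M] [Module A M] :
    IsPowTorsion J (powTorsion J M) := by
  rintro ⟨m, n, hn⟩
  exact ⟨n, fun a ha => Subtype.ext (hn a ha)⟩

/-- A power of `J` kills a finitely generated `J`-power torsion module. -/
theorem IsPowTorsion.exists_pow_smul_eq_zero {M : Type*} [AddCommGroup M] [Module A M]
    [Module.Finite A M] (hM : IsPowTorsion J M) : ∃ n : ℕ, ∀ a ∈ J ^ n, ∀ m : M, a • m = 0 := by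
  obtain ⟨S, hS⟩ := ‹Module.Finite A M›
  choose n hn using hM
  refine ⟨S.sup n, fun a ha m => ?_⟩
  have hm : m ∈ Submodule.span A (S : Set M) := hS ▸ Submodule.mem_top
  induction hm using Submodule.span_induction with
  | mem x hx => exact hn x a (Ideal.pow_le_pow_right (Finset.le_sup hx) ha)
  | zero => simp
  | add x y _ _ hx hy => rw [smul_add, hx, hy, add_zero]
  | smul b x _ hx => rw [smul_comm, hx, smul_zero]

/-- The `J`-power torsion of an injective module over a Noetherian ring is injective. -/
theorem Injective.powTorsion [IsNoetherianRing A] {I : Type u} [AddCommGroup I] [Module A I]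
    (hI : Module.Injective A I) : Module.Injective A (powTorsion J I) := by
  refine Module.Baer.injective fun 𝔞 g => ?_
  have : IsPowTorsion J (LinearMap.range g) := fun m => by
    obtain ⟨n, hn⟩ := isPowTorsion_powTorsion J I m.1
    exact ⟨n, fun a ha => Subtype.ext (hn a ha)⟩
  obtain ⟨n, hn⟩ := this.exists_pow_smul_eq_zero
  -- Artin–Rees: `J^(n+k) ∩ 𝔞 ⊆ J^n 𝔞`, and `g` kills `J^n 𝔞`.
  obtain ⟨k, hk⟩ := Ideal.exists_pow_inf_eq_pow_smul J 𝔞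
  have hJ : J ^ (n + k) ⊓ 𝔞 ≤ J ^ n • 𝔞 := by
    have := hk (n + k) (by lia)
    simp only [smul_eq_mul, Ideal.mul_top, Nat.add_sub_cancel] at this
    rw [this]
    exact Ideal.mul_mono_right inf_le_right
  have hker : Submodule.comap 𝔞.subtype (J ^ (n + k)) ≤
      LinearMap.ker ((Module.powTorsion J I).subtype ∘ₗ g) := by
    have h1 : J ^ n • (⊤ : Submodule A 𝔞) ≤ LinearMap.ker g := by
      rw [Submodule.smul_le]
      rintro a ha x -
      have := hn a ha ⟨g x, x, rfl⟩
      rw [LinearMap.mem_ker, map_smul]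
      exact congr(($this).1)
    intro x hx
    have h2 : x.1 ∈ (J ^ n • (⊤ : Submodule A 𝔞)).map 𝔞.subtype := by
      rw [Submodule.map_smul'', Submodule.map_top, Submodule.range_subtype]
      exact hJ ⟨hx, x.2⟩
    obtain ⟨y, hy, hyx⟩ := h2
    obtain rfl : y = x := Subtype.ext hyx
    have := h1 hy
    rw [LinearMap.mem_ker] at this
    rw [LinearMap.mem_ker, LinearMap.comp_apply, this, map_zero]
  -- The map `g` descends to `𝔞/(J^(n+k) ∩ 𝔞)`. Extending from there to `A/J^(n+k)`, rather than to
  -- `A`, forces the values of the extension to be torsion.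
  obtain ⟨h, hh⟩ := hI.out
    (Submodule.mapQ (Submodule.comap 𝔞.subtype (J ^ (n + k))) (J ^ (n + k)) 𝔞.subtype le_rfl)
    (by
      rw [← LinearMap.ker_eq_bot, Submodule.ker_mapQ]
      exact Submodule.mkQ_map_self _)
    (Submodule.liftQ _ _ hker)
  have hmem (x : A) : h (Submodule.Quotient.mk x) ∈ Module.powTorsion J I := by
    refine ⟨n + k, fun a ha => ?_⟩
    rw [← map_smul, ← Submodule.Quotient.mk_smul, (Submodule.Quotient.mk_eq_zero _).mpr, map_zero]
    exact Ideal.mul_mem_right _ _ ha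
  refine ⟨(h ∘ₗ Submodule.mkQ _).codRestrict _ hmem, fun x hx => Subtype.ext ?_⟩
  exact hh (Submodule.Quotient.mk ⟨x, hx⟩)

end Module

/-! ### Vanishing in the directed system; power torsion modules -/

namespace localCohomology

variable {A : Type u} [CommRing A] {J : Ideal A}

theorem restr_restr {M : ModuleCat.{u} A} {i t s r : ℕ} (h : t ≤ s) (h' : s ≤ r)
    (x : Abelian.Ext (quotPow J t) M i) :
    restr h' (restr h x) = restr (h.trans h') x := by
  simp only [restr, Abelian.Ext.mk₀_comp_mk₀_assoc]
  congr 2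
  ext
  rfl

theorem restr_zero {M : ModuleCat.{u} A} {i t s : ℕ} (h : t ≤ s) :
    restr h (0 : Abelian.Ext (quotPow J t) M i) = 0 := by
  simp [restr]

theorem restr_smul {M : ModuleCat.{u} A} {i t s : ℕ} (h : t ≤ s) (a : A)
    (x : Abelian.Ext (quotPow J t) M i) : restr h (a • x) = a • restr h x := by
  simp [restr]

theorem restr_comp {M N : ModuleCat.{u} A} {i j k t s : ℕ} (h : t ≤ s)
    (x : Abelian.Ext (quotPow J t) M i) (y : Abelian.Ext M N j) (hk : i + j = k) :
    restr h (x.comp y hk) = (restr h x).comp y hk :=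
  (Abelian.Ext.comp_assoc _ _ _ (zero_add i) hk (by lia)).symm

/-- The scalar action on `Ext` can be computed in the first variable, where `J^t` acts by zero. -/
theorem smul_eq_zero_of_mem_pow {M : ModuleCat.{u} A} {i t : ℕ} {a : A} (ha : a ∈ J ^ t)
    (x : Abelian.Ext (quotPow J t) M i) : a • x = 0 := by
  have h0 : a • 𝟙 (quotPow J t) = 0 := by
    refine ModuleCat.hom_ext (LinearMap.ext fun y => ?_)
    obtain ⟨y, rfl⟩ := Ideal.Quotient.mk_surjective y
    change a • (Ideal.Quotient.mk (J ^ t)) y = 0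
    rw [Algebra.smul_def, Ideal.Quotient.algebraMap_eq, ← map_mul, Ideal.Quotient.eq_zero_iff_mem]
    exact Ideal.mul_mem_right _ _ ha
  calc a • x = (Abelian.Ext.mk₀ (a • 𝟙 (quotPow J t))).comp x (zero_add i) := by
        simp [Abelian.Ext.mk₀_smul]
    _ = 0 := by rw [h0]; simp

variable (J) in
/-- The vanishing of the `i`-th local cohomology of `M` with support in `J`, on the level of the
directed system of `Ext` modules. -/
def Vanishes (M : ModuleCat.{u} A) (i : ℕ) : Prop :=
  ∀ t (x : Abelian.Ext (quotPow J t) M i), ∃ s, ∃ h : t ≤ s, restr h x = 0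

variable {S : ShortComplex (ModuleCat.{u} A)} (hS : S.ShortExact)

-- A class in the middle term dies in `S.X₃` after one restriction; it then comes from `S.X₁`, where
-- a second restriction kills it.
include hS in
theorem Vanishes.of_shortExact {i : ℕ} (h₁ : Vanishes J S.X₁ i) (h₃ : Vanishes J S.X₃ i) :
    Vanishes J S.X₂ i := by
  intro t x
  obtain ⟨s, hs, h⟩ := h₃ t (x.comp (Abelian.Ext.mk₀ S.g) (add_zero i))
  rw [restr_comp] at h
  obtain ⟨y, hy⟩ := Abelian.Ext.covariant_sequence_exact₂ _ hS _ h
  obtain ⟨r, hr, h'⟩ := h₁ s y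
  refine ⟨r, hs.trans hr, ?_⟩
  rw [← restr_restr hs hr, ← hy, restr_comp, h', Abelian.Ext.zero_comp]

include hS in
/-- If the previous local cohomology of the cokernel vanishes, then any class that dies in the
middle term dies. -/
theorem exists_restr_eq_zero {i : ℕ} (h₃ : Vanishes J S.X₃ i) {t : ℕ}
    (x : Abelian.Ext (quotPow J t) S.X₁ (i + 1))
    (hx : x.comp (Abelian.Ext.mk₀ S.f) (add_zero _) = 0) : ∃ s, ∃ h : t ≤ s, restr h x = 0 := by
  obtain ⟨y, rfl⟩ := Abelian.Ext.covariant_sequence_exact₁ _ hS x hx rfl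
  obtain ⟨s, hs, h⟩ := h₃ t y
  exact ⟨s, hs, by rw [restr_comp, h, Abelian.Ext.zero_comp]⟩

/-- Any module `M` embeds into an injective module, a power torsion one if `M` is power torsion. -/
theorem exists_shortExact_injective [IsNoetherianRing A] (M : ModuleCat.{u} A)
    (hM : Module.IsPowTorsion J M) :
    ∃ S : ShortComplex (ModuleCat.{u} A), S.ShortExact ∧ S.X₁ = M ∧ Injective S.X₂ ∧
      Module.IsPowTorsion J S.X₂ := by
  let I := Injective.under M
  have : Injective (ModuleCat.of A I) := inferInstanceAs (Injective (Injective.under M))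
  have hI : Module.Injective A I := Module.injective_module_of_injective_object A I
  let f : M →ₗ[A] Module.powTorsion J I :=
    (Injective.ι M).hom.codRestrict _ fun m => by
      obtain ⟨n, hn⟩ := hM m
      exact ⟨n, fun a ha => by rw [← map_smul, hn a ha, map_zero]⟩
  have hf : Function.Injective f := fun x y hxy =>
    (ModuleCat.mono_iff_injective _).mp (inferInstance : Mono (Injective.ι M))
      congr(($hxy).1)
  have := hI.powTorsion (J := J)
  refine ⟨ModuleCat.shortComplexOfCompEqZero f (LinearMap.range f).mkQ
    (LinearMap.range_mkQ_comp f), ?_, rfl,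
    Module.injective_object_of_injective_module A _, Module.isPowTorsion_powTorsion J I⟩
  exact ModuleCat.shortComplex_shortExact _ (LinearMap.exact_map_mkQ_range f) hf
    (Submodule.mkQ_surjective _)

/-- Dimension shifting along an embedding into a power torsion injective module: the cokernel is
again power torsion, and `Ext` into an injective vanishes in positive degrees. Only degree one needs
a direct argument. -/
theorem Vanishes.of_isPowTorsion [IsNoetherianRing A] (i : ℕ) (M : ModuleCat.{u} A)
    (hM : Module.IsPowTorsion J M) : Vanishes J M (i + 1) := by
  induction i generalizing M with
  | zero =>
    obtain ⟨S, hS, rfl, hI, hT⟩ := exists_shortExact_injective M hM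
    intro t x
    obtain ⟨y, rfl⟩ := Abelian.Ext.covariant_sequence_exact₁ _ hS x
      (Abelian.Ext.eq_zero_of_injective _) rfl
    obtain ⟨c, rfl⟩ := Abelian.Ext.addEquiv₀.symm.surjective y
    -- A degree one class is the connecting image of some `c : A/J^t → S.X₃`. A lift `j` of `c 1` is
    -- killed by some `J^n`, so `c` lifts to `S.X₂` on `A/J^(max t n)`, and there its connecting
    -- image vanishes.
    obtain ⟨j, hj⟩ := hS.moduleCat_surjective_g (c (Ideal.Quotient.mk (J ^ t) 1))
    obtain ⟨n, hn⟩ := hT j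
    let h : quotPow J (max t n) ⟶ S.X₂ :=
      ModuleCat.ofHom (Submodule.liftQ _ (LinearMap.toSpanSingleton A S.X₂ j) fun a ha =>
        hn a (Ideal.pow_le_pow_right (le_max_right _ _) ha))
    have hh : quotPowMap J (le_max_left t n) ≫ c = h ≫ S.g := by
      ext
      change c (Ideal.Quotient.mk (J ^ t) 1) = S.g ((1 : A) • j)
      rw [one_smul, hj]
    refine ⟨max t n, le_max_left _ _, ?_⟩
    rw [restr_comp]
    simp only [restr, Abelian.Ext.addEquiv₀_symm_apply, Abelian.Ext.mk₀_comp_mk₀]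
    rw [hh, ← Abelian.Ext.mk₀_comp_mk₀, Abelian.Ext.comp_assoc_of_second_deg_zero,
      ShortComplex.ShortExact.comp_extClass, Abelian.Ext.comp_zero]
  | succ i ih =>
    obtain ⟨S, hS, rfl, hI, hT⟩ := exists_shortExact_injective M hM
    exact fun t x => exists_restr_eq_zero hS
      (ih _ (hT.of_surjective S.g.hom hS.moduleCat_surjective_g)) x
      (Abelian.Ext.eq_zero_of_injective _)

end localCohomology

/-! ### Dévissage and Grothendieck vanishing -/

namespace localCohomology

variable {A : Type u} [CommRing A] {J : Ideal A}

theorem Vanishes.of_subsingleton (M : ModuleCat.{u} A) [Subsingleton M] (i : ℕ) :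
    Vanishes J M i := by
  refine fun t x => ⟨t, le_rfl, ?_⟩
  have h : 𝟙 M = 0 := by ext y; exact Subsingleton.elim _ _
  rw [← Abelian.Ext.comp_mk₀_id x, h, Abelian.Ext.mk₀_zero, Abelian.Ext.comp_zero, restr_zero]

/-- If `a ∈ J` is a nonzerodivisor on `M` and the previous local cohomology of `M ⧸ aM` vanishes
then that of `M` does. -/
theorem Vanishes.of_smul_injective {M : ModuleCat.{u} A} {a : A} (ha : a ∈ J)
    (hM : Function.Injective (LinearMap.lsmul A M a)) {i : ℕ}
    (h : Vanishes J (ModuleCat.of A (M ⧸ LinearMap.range (LinearMap.lsmul A M a))) i) :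
    Vanishes J M (i + 1) := by
  let S := ModuleCat.shortComplexOfCompEqZero (LinearMap.lsmul A M a)
    (LinearMap.range (LinearMap.lsmul A M a)).mkQ (LinearMap.range_mkQ_comp _)
  have hS : S.ShortExact := ModuleCat.shortComplex_shortExact _
    (LinearMap.exact_map_mkQ_range _) hM (Submodule.mkQ_surjective _)
  -- In the limit, multiplication by `a` is injective in degree `i + 1`, because the `i`-th local
  -- cohomology of `M/aM` vanishes. A class in `Ext(A/J^t, M)` is killed by `a^t`, so factors of `a`
  -- are removed one at a time.
  have key (k : ℕ) : ∀ t (x : Abelian.Ext (quotPow J t) M (i + 1)), a ^ k • x = 0 →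
      ∃ s, ∃ h : t ≤ s, restr h x = 0 := by
    induction k with
    | zero => exact fun t x hx => ⟨t, le_rfl, by rw [pow_zero, one_smul] at hx; rw [hx, restr_zero]⟩
    | succ k ih =>
      intro t x hx
      have hf : S.f = a • 𝟙 M := by ext; rfl
      obtain ⟨s, hs, h'⟩ := exists_restr_eq_zero hS h (a ^ k • x) (by
        rw [hf, ← Abelian.Ext.smul_eq_comp_mk₀ (R := A), smul_smul, ← pow_succ', hx])
      rw [restr_smul] at h'
      obtain ⟨r, hr, h''⟩ := ih s _ h'
      exact ⟨r, hs.trans hr, by rw [← restr_restr hs hr, h'']⟩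
  exact fun t x => key t t x (smul_eq_zero_of_mem_pow (Ideal.pow_mem_pow ha t) x)

theorem smul_eq_zero_of_equiv_quotient {N : Type*} [AddCommGroup N] [Module A N] {I : Ideal A}
    (e : N ≃ₗ[A] A ⧸ I) {a : A} (ha : a ∈ I) (m : N) : a • m = 0 := by
  apply e.injective
  obtain ⟨y, hy⟩ := Ideal.Quotient.mk_surjective (e m)
  rw [map_smul, map_zero, ← hy, Algebra.smul_def, Ideal.Quotient.algebraMap_eq, ← map_mul,
    Ideal.Quotient.eq_zero_iff_mem]
  exact Ideal.mul_mem_right _ _ ha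

variable [IsNoetherianRing A]

/-- Devissage: vanishing for a finitely generated module follows from the vanishing for the
cyclic modules `A ⧸ Q` with `Q` prime and containing the annihilator. -/
theorem Vanishes.of_prime_quotient {i : ℕ} {𝔞 : Ideal A}
    (h : ∀ Q : PrimeSpectrum A, 𝔞 ≤ Q.asIdeal → ∀ N : ModuleCat.{u} A,
      (N ≃ₗ[A] A ⧸ Q.asIdeal) → Vanishes J N i)
    (M : Type u) [AddCommGroup M] [Module A M] [Module.Finite A M]
    (hM : ∀ a ∈ 𝔞, ∀ m : M, a • m = 0) : Vanishes J (ModuleCat.of A M) i := by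
  revert hM
  induction ‹Module.Finite A M› using
    IsNoetherianRing.induction_on_isQuotientEquivQuotientPrime A with
  | subsingleton N => exact fun _ => Vanishes.of_subsingleton _ _
  | quotient N Q e =>
    refine fun hN => h Q (fun a ha => ?_) _ e
    have := congr(e $(hN a ha (e.symm (Ideal.Quotient.mk _ 1))))
    rw [map_smul, e.apply_symm_apply, map_zero, Algebra.smul_def, map_one, mul_one] at this
    exact Ideal.Quotient.eq_zero_iff_mem.mp this
  | exact N₁ N₂ N₃ f g hf hg hfg h₁ h₃ =>
    intro hN
    let S := ModuleCat.shortComplexOfCompEqZero f g hfg.linearMap_comp_eq_zero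
    have hS : S.ShortExact := ModuleCat.shortComplex_shortExact _ hfg hf hg
    refine Vanishes.of_shortExact hS (h₁ fun a ha m => hf ?_) (h₃ fun a ha m => ?_)
    · rw [map_smul, hN a ha, map_zero]
    · obtain ⟨m, rfl⟩ := hg m
      rw [← map_smul, hN a ha, map_zero]

variable [IsLocalRing A]
open IsLocalRing

/-- Induction on a bound for `dim A/P`. If `P` is maximal, `A/P` is torsion. Otherwise some `x ∈ 𝔪 \
P` is a nonzerodivisor on `A/P`, and `A/(P + (x))` is filtered by quotients by primes strictly
larger than `P`, whose coheight is smaller. -/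
theorem Vanishes.quotient_prime (n : ℕ) (P : PrimeSpectrum A) (hP : Order.coheight P ≤ n) (i : ℕ)
    (hi : n < i) (N : ModuleCat.{u} A) (e : N ≃ₗ[A] A ⧸ P.asIdeal) :
    Vanishes (maximalIdeal A) N i := by
  induction n generalizing P i N with
  | zero =>
    have hmax : P.asIdeal = maximalIdeal A := by
      have h1 : IsMax P := Order.coheight_eq_zero.mp (by simpa using hP)
      exact eq_maximalIdeal (PrimeSpectrum.isMax_iff.mp h1)
    obtain ⟨i, rfl⟩ := Nat.exists_eq_succ_of_ne_zero hi.ne'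
    refine Vanishes.of_isPowTorsion i N fun m => ⟨1, fun a ha => ?_⟩
    exact smul_eq_zero_of_equiv_quotient e (by rwa [pow_one, ← hmax] at ha) m
  | succ n ih =>
    obtain ⟨i, rfl⟩ := Nat.exists_eq_succ_of_ne_zero (by lia : i ≠ 0)
    by_cases hPm : maximalIdeal A ≤ P.asIdeal
    · refine Vanishes.of_isPowTorsion i N fun m => ⟨1, fun a ha => ?_⟩
      exact smul_eq_zero_of_equiv_quotient e (hPm (by rwa [pow_one] at ha)) m
    · obtain ⟨x, hx, hxP⟩ := Set.not_subset.mp hPm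
      have hinj : Function.Injective (LinearMap.lsmul A N x) := by
        rw [← LinearMap.ker_eq_bot, LinearMap.ker_eq_bot']
        intro m hm
        apply e.injective
        have := congr(e $hm)
        rw [LinearMap.lsmul_apply, map_smul, map_zero] at this
        obtain ⟨y, hy⟩ := Ideal.Quotient.mk_surjective (e m)
        rw [← hy, Algebra.smul_def, Ideal.Quotient.algebraMap_eq, ← map_mul,
          Ideal.Quotient.eq_zero_iff_mem] at this
        rw [← hy, map_zero, Ideal.Quotient.eq_zero_iff_mem]
        exact (P.2.mem_or_mem this).resolve_left hxP
      refine Vanishes.of_smul_injective hx hinj ?_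
      have : Module.Finite A N := Module.Finite.equiv e.symm
      refine Vanishes.of_prime_quotient (𝔞 := P.asIdeal ⊔ Ideal.span {x}) (fun Q hQ N' e' => ?_) _
        ?_
      · have hlt : P < Q := by
          refine lt_of_le_of_ne (le_sup_left.trans hQ) ?_
          rintro rfl
          exact hxP ((le_sup_right.trans hQ) (Ideal.mem_span_singleton_self x))
        have h1 := (Order.coheight_add_one_le hlt).trans hP
        refine ih Q ?_ i (by lia) N' e'
        push_cast at h1
        exact (ENat.add_le_add_iff_right (by simp)).mp h1
      · intro a ha m
        obtain ⟨m, rfl⟩ := Submodule.mkQ_surjective _ m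
        rw [← map_smul, Submodule.mkQ_apply, Submodule.Quotient.mk_eq_zero]
        obtain ⟨b, hb, c, hc, rfl⟩ := Submodule.mem_sup.mp ha
        obtain ⟨c, rfl⟩ := Ideal.mem_span_singleton'.mp hc
        have h0 : b • m = 0 := smul_eq_zero_of_equiv_quotient e hb m
        refine ⟨c • m, ?_⟩
        rw [add_smul, h0, zero_add, mul_smul, smul_comm]
        rfl

/-- **Grothendieck vanishing**: the local cohomology of finitely generated modules vanishes
above the dimension of the ring. -/
theorem Vanishes.of_ringKrullDim_lt {d : ℕ} (hd : ringKrullDim A = d) (M : Type u)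
    [AddCommGroup M] [Module A M] [Module.Finite A M] {i : ℕ} (hi : d < i) :
    Vanishes (maximalIdeal A) (ModuleCat.of A M) i := by
  refine Vanishes.of_prime_quotient (𝔞 := ⊥) (fun Q _ N e => ?_) M (by simp)
  refine Vanishes.quotient_prime d Q ?_ i hi N e
  have := Order.coheight_le_krullDim Q
  rw [show Order.krullDim (PrimeSpectrum A) = d from hd] at this
  exact_mod_cast this

end localCohomology

/-! ### Linear functors right exact on finite modules are tensor products -/

namespace CategoryTheory.Functor

variable {A : Type u} [CommRing A] (F G : ModuleCat.{u} A ⥤ ModuleCat.{u} A)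

/-- Right exactness on finitely generated modules. -/
def IsRightExactOnFinite : Prop :=
  ∀ S : ShortComplex (ModuleCat.{u} A), S.ShortExact → Module.Finite A S.X₁ →
    Module.Finite A S.X₂ → Function.Surjective (F.map S.g) ∧
      ∀ y, F.map S.g y = 0 → ∃ z, F.map S.f z = y

section Tensor

variable [F.Additive] [F.Linear A]

/-- The canonical map `M ⊗ F(A) → F(M)`. -/
def tensorComparison (M : ModuleCat.{u} A) :
    M ⊗[A] F.obj (ModuleCat.of A A) →ₗ[A] F.obj M :=
  TensorProduct.lift
    { toFun m := (F.map (ModuleCat.ofHom (LinearMap.toSpanSingleton A M m))).hom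
      map_add' m m' := by
        rw [LinearMap.toSpanSingleton_add, ModuleCat.ofHom_add, F.map_add, ModuleCat.hom_add]
      map_smul' a m := by
        have h : ModuleCat.ofHom (LinearMap.toSpanSingleton A M (a • m)) =
            a • ModuleCat.ofHom (LinearMap.toSpanSingleton A M m) := by
          rw [LinearMap.toSpanSingleton_smul]
          rfl
        rw [h, F.map_smul, ModuleCat.hom_smul, RingHom.id_apply] }

theorem tensorComparison_tmul (M : ModuleCat.{u} A) (m : M) (t : F.obj (ModuleCat.of A A)) :
    F.tensorComparison M (m ⊗ₜ t) =
      F.map (ModuleCat.ofHom (LinearMap.toSpanSingleton A M m)) t := rfl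

theorem map_tensorComparison {M N : ModuleCat.{u} A} (f : M ⟶ N)
    (z : M ⊗[A] F.obj (ModuleCat.of A A)) :
    F.map f (F.tensorComparison M z) = F.tensorComparison N (f.hom.rTensor _ z) := by
  induction z with
  | zero => simp
  | add z z' h h' =>
    simp only [_root_.map_add, h, h']
  | tmul m t =>
    rw [LinearMap.rTensor_tmul, tensorComparison_tmul, tensorComparison_tmul,
      ← ConcreteCategory.comp_apply, ← F.map_comp]
    congr 3
    ext
    simp

/-- The inverse of `tensorComparison` on finite free modules. -/
def tensorComparisonInv (n : ℕ) (h : F.obj (ModuleCat.of A (Fin n → A))) :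
    (Fin n → A) ⊗[A] F.obj (ModuleCat.of A A) :=
  ∑ i, (Pi.single i 1 : Fin n → A) ⊗ₜ F.map (ModuleCat.ofHom (LinearMap.proj i)) h

/-- Additivity of `F`, applied to the identity of `A^n` written as a sum of projections followed by
inclusions. -/
theorem tensorComparison_inv (n : ℕ) (h : F.obj (ModuleCat.of A (Fin n → A))) :
    F.tensorComparison (ModuleCat.of A (Fin n → A)) (F.tensorComparisonInv n h) = h := by
  have hid : ∑ i : Fin n, (ModuleCat.ofHom (LinearMap.proj i) : ModuleCat.of A (Fin n → A) ⟶
      ModuleCat.of A A) ≫ ModuleCat.ofHom (LinearMap.toSpanSingleton A _ (Pi.single i 1)) =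
      𝟙 (ModuleCat.of A (Fin n → A)) := by
    ext x j
    simp [ModuleCat.hom_sum, Pi.single_apply, ite_apply, eq_comm]
  have h1 := congr($(F.congr_map hid) h)
  rw [F.map_sum, F.map_id] at h1
  refine Eq.trans ?_ h1
  refine (_root_.map_sum (F.tensorComparison (ModuleCat.of A (Fin n → A))) _ _).trans ?_
  refine Eq.trans ?_ congr($(ModuleCat.hom_sum _ _) h).symm
  rw [LinearMap.sum_apply]
  refine Finset.sum_congr rfl fun i _ => ?_
  rw [F.map_comp]
  rfl

theorem inv_tensorComparison (n : ℕ) (z : (Fin n → A) ⊗[A] F.obj (ModuleCat.of A A)) :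
    F.tensorComparisonInv n (F.tensorComparison (ModuleCat.of A (Fin n → A)) z) = z := by
  induction z with
  | zero => simp [tensorComparisonInv]
  | add z z' h h' =>
    rw [_root_.map_add]
    conv_rhs => rw [← h, ← h']
    simp [tensorComparisonInv, TensorProduct.tmul_add, Finset.sum_add_distrib]
  | tmul m t =>
    have h1 (i : Fin n) : F.map (ModuleCat.ofHom (LinearMap.proj i))
        (F.tensorComparison (ModuleCat.of A (Fin n → A)) (m ⊗ₜ t)) = m i • t := by
      rw [tensorComparison_tmul, ← ConcreteCategory.comp_apply, ← F.map_comp]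
      have : ModuleCat.ofHom (LinearMap.toSpanSingleton A (Fin n → A) m) ≫
          ModuleCat.ofHom (LinearMap.proj i) = m i • 𝟙 (ModuleCat.of A A) := by
        ext
        simp
      rw [this, F.map_smul, F.map_id]
      rfl
    simp only [tensorComparisonInv, h1, ← TensorProduct.smul_tmul, ← TensorProduct.sum_tmul]
    congr 1
    ext j
    simp [Pi.single_apply]

theorem tensorComparison_surjective (hF : F.IsRightExactOnFinite) [IsNoetherianRing A]
    (M : Type u) [AddCommGroup M] [Module A M] [Module.Finite A M] :
    Function.Surjective (F.tensorComparison (ModuleCat.of A M)) := by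
  intro y
  obtain ⟨n, π, hπ⟩ := Module.Finite.exists_fin' A M
  obtain ⟨y, rfl⟩ := (hF _ (LinearMap.shortExact_shortComplexKer hπ) inferInstance
    inferInstance).1 y
  refine ⟨_, ((F.map_tensorComparison (ModuleCat.ofHom π) (F.tensorComparisonInv n y))).symm.trans
    ?_⟩
  rw [tensorComparison_inv]

/-- A five lemma chase for `0 → ker π → A^n → M → 0`: the comparison is bijective at `A^n`, and at
the finitely generated module `ker π` surjectivity is enough. -/
theorem tensorComparison_injective (hF : F.IsRightExactOnFinite) [IsNoetherianRing A]
    (M : Type u) [AddCommGroup M] [Module A M] [Module.Finite A M] :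
    Function.Injective (F.tensorComparison (ModuleCat.of A M)) := by
  rw [← LinearMap.ker_eq_bot, LinearMap.ker_eq_bot']
  intro z hz
  obtain ⟨n, π, hπ⟩ := Module.Finite.exists_fin' A M
  obtain ⟨z, rfl⟩ := LinearMap.rTensor_surjective _ hπ z
  have h1 := F.map_tensorComparison (ModuleCat.ofHom π) z
  obtain ⟨y, hy⟩ := (hF _ (LinearMap.shortExact_shortComplexKer hπ) inferInstance
    inferInstance).2 _ (h1.trans hz)
  obtain ⟨w, rfl⟩ := F.tensorComparison_surjective hF _ y
  have h2 := (F.map_tensorComparison (ModuleCat.ofHom (LinearMap.ker π).subtype) w).symm.trans hy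
  have h3 := congr(F.tensorComparisonInv n $h2)
  have h4 : (LinearMap.ker π).subtype.rTensor _ w = z :=
    (F.inv_tensorComparison n _).symm.trans (h3.trans (F.inv_tensorComparison n z))
  rw [← h4, ← LinearMap.comp_apply, ← LinearMap.rTensor_comp]
  have : π ∘ₗ (LinearMap.ker π).subtype = 0 := by ext x; exact x.2
  rw [this, LinearMap.rTensor_zero, LinearMap.zero_apply]

end Tensor

/-- A linear functor that is right exact on finitely generated modules is determined on them by
its value at the ring: injectivity of the image of a morphism depends only on this value. -/
theorem map_injective_iff_rTensor [F.Additive] [F.Linear A] (hF : F.IsRightExactOnFinite)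
    [IsNoetherianRing A] {M N : ModuleCat.{u} A} [Module.Finite A M] [Module.Finite A N]
    (f : M ⟶ N) : Function.Injective (F.map f) ↔
      Function.Injective (f.hom.rTensor (F.obj (ModuleCat.of A A))) := by
  have hM : Function.Bijective (F.tensorComparison M) :=
    ⟨F.tensorComparison_injective hF M, F.tensorComparison_surjective hF M⟩
  have hN : Function.Injective (F.tensorComparison N) := F.tensorComparison_injective hF N
  have h : F.map f ∘ F.tensorComparison M = F.tensorComparison N ∘ f.hom.rTensor _ :=
    funext (F.map_tensorComparison f)
  rw [← Function.Injective.of_comp_iff' _ hM, h, hN.of_comp_iff]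

/-- Any `A`-isomorphism of the values at `A` suffices, with no natural transformation given in
advance, since `id ⊗ e` automatically commutes with `f ⊗ id`. A canonical module supplies just such
an isomorphism. -/
theorem map_injective_iff_of_equiv [F.Additive] [F.Linear A] [G.Additive] [G.Linear A]
    (hF : F.IsRightExactOnFinite) (hG : G.IsRightExactOnFinite)
    (e : F.obj (ModuleCat.of A A) ≃ₗ[A] G.obj (ModuleCat.of A A))
    [IsNoetherianRing A] {M N : ModuleCat.{u} A} [Module.Finite A M] [Module.Finite A N]
    (f : M ⟶ N) : Function.Injective (F.map f) ↔ Function.Injective (G.map f) := by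
  rw [F.map_injective_iff_rTensor hF, G.map_injective_iff_rTensor hG]
  have h : (e.lTensor N).toLinearMap ∘ₗ f.hom.rTensor (F.obj (ModuleCat.of A A)) =
      f.hom.rTensor (G.obj (ModuleCat.of A A)) ∘ₗ (e.lTensor M).toLinearMap := by
    ext
    simp
  have h' : (e.lTensor N) ∘ f.hom.rTensor (F.obj (ModuleCat.of A A)) =
      f.hom.rTensor (G.obj (ModuleCat.of A A)) ∘ (e.lTensor M) :=
    congrArg DFunLike.coe h
  rw [← (e.lTensor N).injective.of_comp_iff, h',
    Function.Injective.of_comp_iff' _ (e.lTensor M).bijective]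

end CategoryTheory.Functor

/-! ### Linearity of local cohomology and right exactness in top degree -/

namespace localCohomology

variable {A : Type u} [CommRing A] (J : Ideal A) (i : ℕ)

instance : (localCohomology J i).Additive where
  map_add {M N f g} := by
    ext y
    obtain ⟨t, x, rfl⟩ := fromExt_jointly_surjective J M i y
    rw [ModuleCat.hom_add, LinearMap.add_apply]
    rw [map_fromExt, map_fromExt, map_fromExt, Abelian.Ext.mk₀_add, Abelian.Ext.comp_add, map_add]

instance : (localCohomology J i).Linear A where
  map_smul {M N} f a := by
    ext y
    obtain ⟨t, x, rfl⟩ := fromExt_jointly_surjective J M i y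
    rw [ModuleCat.hom_smul, LinearMap.smul_apply]
    rw [map_fromExt, map_fromExt, Abelian.Ext.mk₀_smul, Abelian.Ext.comp_smul, map_smul]

-- The obstruction to lifting a class is its connecting image in degree `i + 1` of `S.X₁`, which
-- dies after a restriction.
variable {J i} in
theorem map_surjective_of_vanishes {S : ShortComplex (ModuleCat.{u} A)} (hS : S.ShortExact)
    (h : Vanishes J S.X₁ (i + 1)) : Function.Surjective ((localCohomology J i).map S.g) := by
  intro y
  obtain ⟨t, x, rfl⟩ := fromExt_jointly_surjective J _ i y
  obtain ⟨s, hs, h'⟩ := h t (x.comp hS.extClass rfl)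
  rw [restr_comp] at h'
  obtain ⟨z, hz⟩ := Abelian.Ext.covariant_sequence_exact₃ _ hS _ _ h'
  exact ⟨fromExt J _ i s z, by rw [map_fromExt, hz, fromExt_restr]⟩

variable {J i} in
theorem exists_map_eq_of_map_eq_zero {S : ShortComplex (ModuleCat.{u} A)} (hS : S.ShortExact)
    (y : (localCohomology J i).obj S.X₂) (hy : (localCohomology J i).map S.g y = 0) :
    ∃ z, (localCohomology J i).map S.f z = y := by
  obtain ⟨t, x, rfl⟩ := fromExt_jointly_surjective J _ i y
  rw [map_fromExt, fromExt_eq_zero_iff] at hy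
  obtain ⟨s, hs, h⟩ := hy
  rw [restr_comp] at h
  obtain ⟨z, hz⟩ := Abelian.Ext.covariant_sequence_exact₂ _ hS _ h
  exact ⟨fromExt J _ i s z, by rw [map_fromExt, hz, fromExt_restr]⟩

/-- Top local cohomology is right exact on finitely generated modules. -/
theorem isRightExactOnFinite [IsLocalRing A] [IsNoetherianRing A] {d : ℕ}
    (hd : ringKrullDim A = d) :
    (localCohomology (IsLocalRing.maximalIdeal A) d).IsRightExactOnFinite :=
  fun S hS _ _ => ⟨map_surjective_of_vanishes hS
    (Vanishes.of_ringKrullDim_lt hd S.X₁ (Nat.lt_succ_self d)), exists_map_eq_of_map_eq_zero hS⟩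

end localCohomology

/-! ### Duality with the canonical module -/

section Duality

variable {A : Type u} [CommRing A]

/-- The functor `M ↦ Hom(Hom(M, ω), E)`. -/
def homHomFunctor (ω E : Type u) [AddCommGroup ω] [Module A ω] [AddCommGroup E] [Module A E] :
    ModuleCat.{u} A ⥤ ModuleCat.{u} A where
  obj M := ModuleCat.of A ((M →ₗ[A] ω) →ₗ[A] E)
  map f := ModuleCat.ofHom (LinearMap.lcomp A E (LinearMap.lcomp A ω f.hom))

variable {ω E : Type u} [AddCommGroup ω] [Module A ω] [AddCommGroup E] [Module A E]

instance : (homHomFunctor (A := A) ω E).Additive where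
  map_add {M N f g} := by
    refine ModuleCat.hom_ext (LinearMap.ext fun (α : (M →ₗ[A] ω) →ₗ[A] E) =>
      LinearMap.ext fun (h : N →ₗ[A] ω) => ?_)
    change α (h ∘ₗ (f.hom + g.hom)) = α (h ∘ₗ f.hom) + α (h ∘ₗ g.hom)
    rw [LinearMap.comp_add, map_add]

instance : (homHomFunctor (A := A) ω E).Linear A where
  map_smul {M N} f a := by
    refine ModuleCat.hom_ext (LinearMap.ext fun (α : (M →ₗ[A] ω) →ₗ[A] E) =>
      LinearMap.ext fun (h : N →ₗ[A] ω) => ?_)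
    change α (h ∘ₗ (a • f.hom)) = a • α (h ∘ₗ f.hom)
    rw [LinearMap.comp_smul, map_smul]

theorem Module.Injective.exists_extension (hE : Module.Injective A E) {X Y : Type u}
    [AddCommGroup X] [Module A X] [AddCommGroup Y] [Module A Y] (f : X →ₗ[A] Y) (g : X →ₗ[A] E)
    (h : LinearMap.ker f ≤ LinearMap.ker g) : ∃ k : Y →ₗ[A] E, k ∘ₗ f = g := by
  obtain ⟨k, hk⟩ := hE.out ((LinearMap.ker f).liftQ f le_rfl)
    (LinearMap.ker_eq_bot.mp (Submodule.ker_liftQ_eq_bot' _ _ rfl)) ((LinearMap.ker f).liftQ g h)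
  exact ⟨k, LinearMap.ext fun x => hk (Submodule.Quotient.mk x)⟩

/-- `Hom(-, ω)` turns right exact sequences into left exact ones, and the exact contravariant
functor `Hom(-, E)` turns these back. -/
theorem homHomFunctor_isRightExactOnFinite (hE : Module.Injective A E) :
    (homHomFunctor (A := A) ω E).IsRightExactOnFinite := by
  intro S hS _ _
  constructor
  · intro (α : (S.X₃ →ₗ[A] ω) →ₗ[A] E)
    have hinj : Function.Injective (LinearMap.lcomp A ω S.g.hom) := fun g g' h =>
      LinearMap.ext fun x => by
        obtain ⟨y, rfl⟩ := hS.moduleCat_surjective_g x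
        exact congr($h y)
    obtain ⟨β, hβ⟩ := hE.exists_extension (LinearMap.lcomp A ω S.g.hom) α
      (by rw [LinearMap.ker_eq_bot.mpr hinj]; exact bot_le)
    exact ⟨β, hβ⟩
  · intro (α : (S.X₂ →ₗ[A] ω) →ₗ[A] E) hα
    obtain ⟨β, hβ⟩ := hE.exists_extension (LinearMap.lcomp A ω S.f.hom) α fun g hg => by
      have hex : Function.Exact S.f.hom S.g.hom :=
        (ShortComplex.ShortExact.moduleCat_exact_iff_function_exact S).mp hS.exact
      have hle : LinearMap.ker S.g.hom ≤ LinearMap.ker g := fun x hx => by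
        obtain ⟨y, rfl⟩ := (hex x).mp hx
        exact congr($hg y)
      have hs : Function.Surjective S.g.hom := hS.moduleCat_surjective_g
      have hg' : ((LinearMap.ker S.g.hom).liftQ g hle ∘ₗ
          (S.g.hom.quotKerEquivOfSurjective hs).symm.toLinearMap) ∘ₗ S.g.hom = g := by
        ext x
        have : (S.g.hom.quotKerEquivOfSurjective hs).symm (S.g.hom x) =
            Submodule.Quotient.mk x := by
          rw [LinearEquiv.symm_apply_eq]
          rfl
        simp [this]
      have := LinearMap.congr_fun hα ((LinearMap.ker S.g.hom).liftQ g hle ∘ₗ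
          (S.g.hom.quotKerEquivOfSurjective hs).symm.toLinearMap)
      rw [LinearMap.mem_ker, ← hg']
      exact this
    exact ⟨β, hβ⟩

/-- The value of the functor `M ↦ Hom(Hom(M, ω), E)` at the ring. -/
def homHomFunctorSelf : (homHomFunctor (A := A) ω E).obj (ModuleCat.of A A) ≃ₗ[A] (ω →ₗ[A] E) :=
  LinearEquiv.congrLeft E A (LinearMap.ringLmapEquivSelf A A ω)

variable [IsLocalRing A]

/-- The annihilator of `x` lies in `𝔪`, so `x ↦ 1` maps `A x` to the residue field, which embeds in
`E`; injectivity extends this map to `X`. -/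
theorem IsInjectiveEnvelopeOfResidueField.exists_ne_zero
    (hE : IsInjectiveEnvelopeOfResidueField A E) {X : Type u} [AddCommGroup X] [Module A X]
    {x : X} (hx : x ≠ 0) : ∃ g : X →ₗ[A] E, g x ≠ 0 := by
  obtain ⟨hinj, i, hi, -⟩ := hE
  have hker : LinearMap.ker (LinearMap.toSpanSingleton A X x) ≤
      LinearMap.ker (LinearMap.toSpanSingleton A E (i 1)) := by
    intro a ha
    have h1 : a ∈ IsLocalRing.maximalIdeal A := by
      rw [IsLocalRing.mem_maximalIdeal, mem_nonunits_iff]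
      intro hu
      exact hx ((hu.smul_eq_zero).mp ha)
    rw [LinearMap.mem_ker, LinearMap.toSpanSingleton_apply, ← map_smul, Algebra.smul_def, mul_one,
      IsLocalRing.ResidueField.algebraMap_eq, (IsLocalRing.residue_eq_zero_iff a).mpr h1, map_zero]
  obtain ⟨g, hg⟩ := hinj.exists_extension _ _ hker
  refine ⟨g, fun h => one_ne_zero (hi (?_ : i 1 = i 0))⟩
  have := congr($hg 1)
  simp only [LinearMap.comp_apply, LinearMap.toSpanSingleton_apply, one_smul] at this
  rw [map_zero, ← this, h]

/-- A nonzero cokernel of `Hom(f, ω)` would carry a nonzero map to `E`, giving a nonzero element in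
the kernel of `Hom(Hom(f, ω), E)`. -/
theorem surjective_of_homHomFunctor_map_injective (hE : IsInjectiveEnvelopeOfResidueField A E)
    {M N : ModuleCat.{u} A} (f : M ⟶ N)
    (hf : Function.Injective ((homHomFunctor ω E).map f)) :
    Function.Surjective (LinearMap.lcomp A ω f.hom) := by
  rw [← LinearMap.range_eq_top]
  by_contra h
  obtain ⟨g, -, hg⟩ := SetLike.exists_of_lt (lt_top_iff_ne_top.mpr h)
  obtain ⟨α, hα⟩ := hE.exists_ne_zero
    (x := (LinearMap.range (LinearMap.lcomp A ω f.hom)).mkQ g) (by simpa using hg)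
  have h0 : LinearMap.lcomp A E (LinearMap.lcomp A ω f.hom)
      (α ∘ₗ (LinearMap.range (LinearMap.lcomp A ω f.hom)).mkQ) = 0 := by
    refine LinearMap.ext fun k => ?_
    change α ((LinearMap.range (LinearMap.lcomp A ω f.hom)).mkQ (LinearMap.lcomp A ω f.hom k)) = 0
    rw [Submodule.mkQ_apply, (Submodule.Quotient.mk_eq_zero _).mpr (LinearMap.mem_range_self _ k),
      map_zero]
  have h1 : α ∘ₗ (LinearMap.range (LinearMap.lcomp A ω f.hom)).mkQ = 0 :=
    hf (h0.trans (map_zero ((homHomFunctor ω E).map f).hom).symm)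
  exact hα congr($h1 g)

/-- A morphism from the canonical module to a finitely generated module is split if and only if
it induces an injection on top local cohomology. -/
theorem IsCanonicalModule.map_injective_iff [IsNoetherianRing A] {d : ℕ}
    (hd : ringKrullDim A = d) (hω : IsCanonicalModule (A := A) d ω) {N : ModuleCat.{u} A}
    [Module.Finite A N] (f : ModuleCat.of A ω ⟶ N) :
    Function.Injective ((localCohomologyAtMax A d).map f) ↔ IsSplitMono f := by
  obtain ⟨hfin, E, _, _, hE, ⟨e⟩⟩ := hω
  constructor
  · intro h
    rw [Functor.map_injective_iff_of_equiv _ (homHomFunctor ω E)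
      (localCohomology.isRightExactOnFinite hd) (homHomFunctor_isRightExactOnFinite hE.1)
      (e.symm ≪≫ₗ homHomFunctorSelf.symm)] at h
    -- A preimage of the identity of `ω` under `Hom(N, ω) → Hom(ω, ω)` is a retraction of `f`.
    obtain ⟨g, hg⟩ := surjective_of_homHomFunctor_map_injective hE f h LinearMap.id
    exact ⟨⟨⟨ModuleCat.ofHom g, ModuleCat.hom_ext hg⟩⟩⟩
  · intro h
    rw [← ModuleCat.mono_iff_injective]
    infer_instance

end Duality

/-! ### Height one primes and the modules `A(D)` -/

section DivisorialModules

variable {A : Type*} [CommRing A]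

/-- Given a prime `p` and finitely many height one primes not contained in `p`, there is an element
outside `p` which vanishes to order at least `n` along them. -/
theorem exists_notMem_forall_mem_pow (p : Ideal A) [hp : p.IsPrime] (S : Finset (HeightOnePrime A))
    (hS : ∀ Q ∈ S, ¬ Q.1.asIdeal ≤ p) (n : ℕ) : ∃ b ∉ p, ∀ Q ∈ S, b ∈ Q.1.asIdeal ^ n := by
  have h : ¬ ∏ Q ∈ S, Q.1.asIdeal ^ n ≤ p := by
    intro h
    obtain ⟨Q, hQ, h'⟩ := (hp.prod_le).mp h
    exact hS Q hQ (hp.le_of_pow_le h')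
  obtain ⟨b, hb, hbp⟩ := Set.not_subset.mp h
  exact ⟨b, hbp, fun Q hQ => (Ideal.prod_le_inf.trans (Finset.inf_le hQ)) hb⟩

variable [IsDomain A]

section

variable [IsNoetherianRing A]

theorem HeightOnePrime.eq_of_le {P : HeightOnePrime A} {Q : Ideal A} [Q.IsPrime] (hQ : Q ≠ ⊥)
    (h : Q ≤ P.1.asIdeal) : Q = P.1.asIdeal := by
  refine Ideal.eq_of_le_of_height_le _ h ?_
  rw [P.2, Order.one_le_iff_ne_zero]
  exact fun h0 => hQ (Ideal.height_eq_zero_iff_eq_bot.mp h0)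

/-- A nonzero element is contained in only finitely many height one primes. -/
theorem finite_setOf_mem_heightOnePrime {a : A} (ha : a ≠ 0) :
    {P : HeightOnePrime A | a ∈ P.1.asIdeal}.Finite := by
  -- A height one prime containing `a ≠ 0` is minimal over `(a)`.
  refine Set.Finite.of_injOn (f := fun P : HeightOnePrime A => P.1.asIdeal)
    (t := (Ideal.span {a}).minimalPrimes) (fun P hP => ?_) (fun P _ Q _ h => ?_)
    (Ideal.finite_minimalPrimes_of_isNoetherianRing A _)
  · refine ⟨⟨P.1.2, (Ideal.span_singleton_le_iff_mem _).mpr hP⟩, fun Q ⟨hQ, haQ⟩ hQP => ?_⟩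
    refine (HeightOnePrime.eq_of_le ?_ hQP).ge
    rintro rfl
    exact ha ((Ideal.span_singleton_le_iff_mem _).mp haQ)
  · exact Subtype.ext (PrimeSpectrum.ext h)

end

variable {L : Type*} [Field L] [Algebra A L] [IsFractionRing A L]

theorem isLocalization_localRingAt (P : HeightOnePrime A) :
    IsLocalization.AtPrime (localRingAt L P) P.1.asIdeal :=
  Localization.subalgebra.isLocalization_ofField L _ _

variable [IsNoetherianRing A] [IsIntegrallyClosed A]

theorem algebraMap_mem_maximalIdeal_localRingAt (P : HeightOnePrime A) (a : A) :
    algebraMap A (localRingAt L P) a ∈ IsLocalRing.maximalIdeal (localRingAt L P) ↔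
      a ∈ P.1.asIdeal := by
  have := isLocalization_localRingAt (L := L) P
  exact IsLocalization.AtPrime.to_map_mem_maximal_iff _ P.1.asIdeal a

variable (L) in
theorem valuationAt_algebraMap_le_one (P : HeightOnePrime A) (a : A) :
    valuationAt L P (algebraMap A L a) ≤ 1 := by
  rw [IsScalarTower.algebraMap_apply A (localRingAt L P) L]
  exact IsDedekindDomain.HeightOneSpectrum.valuation_le_one _ _

variable (L) in
theorem valuationAt_algebraMap_eq_one {P : HeightOnePrime A} {a : A} (ha : a ∉ P.1.asIdeal) :
    valuationAt L P (algebraMap A L a) = 1 := by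
  rw [IsScalarTower.algebraMap_apply A (localRingAt L P) L]
  refine (IsDedekindDomain.HeightOneSpectrum.valuation_eq_one_iff_notMem _).mpr ?_
  exact fun h => ha ((algebraMap_mem_maximalIdeal_localRingAt P a).mp h)

variable (L) in
theorem valuationAt_algebraMap_le_exp {P : HeightOnePrime A} {a : A} {n : ℕ}
    (ha : a ∈ P.1.asIdeal ^ n) : valuationAt L P (algebraMap A L a) ≤ WithZero.exp (-(n : ℤ)) := by
  rw [IsScalarTower.algebraMap_apply A (localRingAt L P) L, valuationAt,
    IsDedekindDomain.HeightOneSpectrum.valuation_of_algebraMap,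
    IsDedekindDomain.HeightOneSpectrum.intValuation_le_pow_iff_mem]
  have h1 : P.1.asIdeal.map (algebraMap A (localRingAt L P)) ≤
      IsLocalRing.maximalIdeal (localRingAt L P) :=
    Ideal.map_le_iff_le_comap.mpr fun x hx =>
      (algebraMap_mem_maximalIdeal_localRingAt P x).mpr hx
  refine Ideal.pow_right_mono h1 n ?_
  rw [← Ideal.map_pow]
  exact Ideal.mem_map_of_mem _ ha

theorem exists_mul_eq_of_valuationAt_le_one {P : HeightOnePrime A} {x : L}
    (hx : valuationAt L P x ≤ 1) :
    ∃ a b : A, b ∉ P.1.asIdeal ∧ x * algebraMap A L b = algebraMap A L a := by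
  have := isLocalization_localRingAt (L := L) P
  obtain ⟨r, d, h⟩ :=
    IsDedekindDomain.HeightOneSpectrum.exists_primeCompl_mul_eq_of_integer _ x hx
  obtain ⟨⟨r', s⟩, hr⟩ := IsLocalization.surj P.1.asIdeal.primeCompl r
  obtain ⟨⟨d', t⟩, hd⟩ := IsLocalization.surj P.1.asIdeal.primeCompl d.1
  have hd' : d' ∉ P.1.asIdeal := by
    rw [← algebraMap_mem_maximalIdeal_localRingAt (L := L) P, ← hd]
    intro h'
    rcases (IsLocalRing.maximalIdeal.isMaximal _).isPrime.mem_or_mem h' with h' | h'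
    · exact d.2 h'
    · exact t.2 ((algebraMap_mem_maximalIdeal_localRingAt (L := L) P _).mp h')
  refine ⟨r' * t, d' * s, fun h' => ?_, ?_⟩
  · rcases P.1.2.mem_or_mem h' with h' | h'
    exacts [hd' h', s.2 h']
  · have hr1 := congr(algebraMap (localRingAt L P) L $hr)
    have hd1 := congr(algebraMap (localRingAt L P) L $hd)
    simp only [map_mul, ← IsScalarTower.algebraMap_apply] at hr1 hd1
    rw [map_mul, map_mul, ← hr1, ← hd1, ← h]
    ring

theorem valuationAt_ne_zero {P : HeightOnePrime A} {x : L} (hx : x ≠ 0) :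
    valuationAt L P x ≠ 0 := (Valuation.ne_zero_iff _).mpr hx

variable (L) in
theorem exists_valuationAt_eq_exp (P : HeightOnePrime A) (n : ℤ) :
    ∃ x : L, x ≠ 0 ∧ valuationAt L P x = WithZero.exp n := by
  obtain ⟨x, hx⟩ := IsDedekindDomain.HeightOneSpectrum.valuation_surjective L
    (IsDiscreteValuationRing.maximalIdeal (localRingAt L P)) (WithZero.exp n)
  exact ⟨x, fun h => WithZero.exp_ne_zero (hx.symm.trans (by rw [h, map_zero])), hx⟩

variable (L) in
theorem finite_setOf_valuationAt_ne_one {x : L} (hx : x ≠ 0) :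
    {P : HeightOnePrime A | valuationAt L P x ≠ 1}.Finite := by
  obtain ⟨a, b, hb, rfl⟩ := IsFractionRing.div_surjective (A := A) x
  have hb0 : b ≠ 0 := nonZeroDivisors.ne_zero hb
  have ha0 : a ≠ 0 := by
    rintro rfl
    simp at hx
  refine ((finite_setOf_mem_heightOnePrime ha0).union
    (finite_setOf_mem_heightOnePrime hb0)).subset fun P hP => ?_
  by_contra h
  rw [Set.mem_union, not_or] at h
  exact hP (by rw [map_div₀, valuationAt_algebraMap_eq_one L h.1,
    valuationAt_algebraMap_eq_one L h.2, div_one])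

/-- A normal Noetherian domain is the intersection of its localizations at height one primes. -/
theorem exists_algebraMap_eq_of_valuationAt_le_one {x : L}
    (hx : ∀ P : HeightOnePrime A, valuationAt L P x ≤ 1) : ∃ a : A, algebraMap A L a = x := by
  by_contra hxA
  let R : Submodule A L := LinearMap.range (Algebra.linearMap A L)
  have hx0 : R.mkQ x ≠ 0 := by
    rw [ne_eq, Submodule.mkQ_apply, Submodule.Quotient.mk_eq_zero]
    exact hxA
  -- Choose an associated prime `P = Ann(z mod A)` of `L/A` containing the annihilator of `x mod A`.
  -- It will turn out to have height one.
  obtain ⟨P, hP, hle⟩ := exists_le_isAssociatedPrime_of_isNoetherianRing A _ hx0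
  obtain ⟨hprime, z, hz⟩ := Submodule.isAssociatedPrime_iff.mp hP
  obtain ⟨z, rfl⟩ := R.mkQ_surjective z
  have hmem (r : A) : r ∈ P ↔ ∃ y, algebraMap A L y = r • z := by
    rw [hz, Submodule.mem_colon_singleton, ← map_smul, Submodule.mem_bot, Submodule.mkQ_apply,
      Submodule.Quotient.mk_eq_zero]
    rfl
  have hmem' (r : A) (hr : r • x ∈ R) : r ∈ P := by
    refine hle ?_
    rwa [Submodule.mem_colon_singleton, ← map_smul, Submodule.mem_bot, Submodule.mkQ_apply,
      Submodule.Quotient.mk_eq_zero]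
  have hbot : P ≠ ⊥ := by
    obtain ⟨a, b, hb, rfl⟩ := IsFractionRing.div_surjective (A := A) x
    intro h
    have hb0 : algebraMap A L b ≠ 0 := by
      simpa using nonZeroDivisors.ne_zero hb
    refine nonZeroDivisors.ne_zero hb (?_ : b ∈ (⊥ : Ideal A))
    rw [← h]
    exact hmem' b ⟨a, by rw [Algebra.smul_def, mul_div_cancel₀ _ hb0]; rfl⟩
  -- If `zP ⊆ P`, then `z` is integral over `A` because `P` is a nonzero finitely generated module;
  -- so `z ∈ A`, which is impossible.
  obtain ⟨r, hrP, t, ht, htP⟩ : ∃ r ∈ P, ∃ t, algebraMap A L t = r • z ∧ t ∉ P := by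
    by_contra! hcon
    have hint : IsIntegral A z := by
      refine isIntegral_of_smul_mem_submodule 
        (Submodule.map (Algebra.linearMap A L) (P : Submodule A A)) ?_ ?_ z ?_
      · obtain ⟨y, hy, hy0⟩ := Submodule.exists_mem_ne_zero_of_ne_bot hbot
        refine (Submodule.ne_bot_iff _).mpr ⟨algebraMap A L y, ⟨y, hy, rfl⟩, by simpa using hy0⟩
      · exact (IsNoetherian.noetherian P).map _
      · rintro _ ⟨y, hy, rfl⟩
        obtain ⟨t, ht⟩ := (hmem y).mp hy
        refine ⟨t, hcon y hy t ht, ?_⟩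
        rw [Algebra.linearMap_apply, ht, Algebra.smul_def, smul_eq_mul, mul_comm]
        rfl
    obtain ⟨y, hy⟩ := IsIntegrallyClosed.isIntegral_iff.mp hint
    exact hprime.ne_top ((Ideal.eq_top_iff_one _).mpr ((hmem 1).mpr ⟨y, by rw [hy, one_smul]⟩))
  -- For `y ∈ P` and `w = yz ∈ A` one has `y t = r w` with `t ∉ P`, so every prime inside `P`
  -- containing `r` contains `P`. Krull's principal ideal theorem then bounds the height.
  have hmin : P ∈ (Ideal.span {r}).minimalPrimes := by
    refine ⟨⟨hprime, (Ideal.span_singleton_le_iff_mem _).mpr hrP⟩, fun Q ⟨hQ, hrQ⟩ hQP y hy => ?_⟩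
    obtain ⟨w, hw⟩ := (hmem y).mp hy
    have h1 : y * t = r * w := by
      apply IsFractionRing.injective A L
      rw [map_mul, map_mul, ht, hw, Algebra.smul_def, Algebra.smul_def]
      ring
    have h2 : y * t ∈ Q := h1 ▸ Ideal.mul_mem_right _ _ (hrQ (Ideal.mem_span_singleton_self r))
    exact (hQ.mem_or_mem h2).resolve_right fun h => htP (hQP h)
  have hht : P.height = 1 := by
    refine le_antisymm (Ideal.height_le_one_of_isPrincipal_of_mem_minimalPrimes _ _ hmin) ?_
    rw [Order.one_le_iff_ne_zero]
    exact fun h0 => hbot (Ideal.height_eq_zero_iff_eq_bot.mp h0)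
  -- Since `x ∈ A_P`, some `b ∉ P` has `b x ∈ A`; but the annihilator of `x mod A` lies in `P`.
  obtain ⟨a, b, hb, hab⟩ := exists_mul_eq_of_valuationAt_le_one (hx ⟨⟨P, hprime⟩, hht⟩)
  exact hb (hmem' b ⟨a, by rw [Algebra.smul_def, mul_comm, hab]; rfl⟩)

variable (L) in
/-- An element of `A(K)` which is a local generator at `P`. -/
theorem exists_valuationAt_eq_exp_forall_le (K : WeilDivisor A ℤ) (P : HeightOnePrime A) :
    ∃ u : L, u ≠ 0 ∧ valuationAt L P u = WithZero.exp (K P) ∧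
      ∀ Q, valuationAt L Q u ≤ WithZero.exp (K Q) := by
  classical
  obtain ⟨x, hx0, hx⟩ := exists_valuationAt_eq_exp L P (K P)
  -- Outside `S` and `P`, both `K` and the valuation of `x` are trivial. An element `b ∉ P`
  -- vanishing to order at least `n` along `S`, where `n` bounds the excess of `x` over `K`, repairs
  -- `x` without changing its value at `P`.
  let S : Finset (HeightOnePrime A) :=
    (K.support ∪ (finite_setOf_valuationAt_ne_one L hx0).toFinset).erase P
  let n : ℕ := S.sup fun Q => (WithZero.log (valuationAt L Q x) - K Q).toNat
  obtain ⟨b, hb, hbS⟩ := exists_notMem_forall_mem_pow P.1.asIdeal S (fun Q hQ hQP =>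
    (Finset.mem_erase.mp hQ).1 (Subtype.ext (PrimeSpectrum.ext
      (HeightOnePrime.eq_of_le (Ideal.ne_bot_of_height_eq_one Q.2) hQP)))) n
  have hb0 : b ≠ 0 := fun h => hb (h ▸ zero_mem _)
  refine ⟨algebraMap A L b * x, mul_ne_zero (by simpa using hb0) hx0, ?_, fun Q => ?_⟩
  · rw [map_mul, valuationAt_algebraMap_eq_one L hb, one_mul, hx]
  · rw [map_mul]
    by_cases hQP : Q = P
    · rw [hQP, valuationAt_algebraMap_eq_one L hb, one_mul, hx]
    by_cases hQ : Q ∈ S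
    · have h1 := valuationAt_algebraMap_le_exp L (hbS Q hQ)
      have h2 : valuationAt L Q x = WithZero.exp (WithZero.log (valuationAt L Q x)) :=
        (WithZero.exp_log (valuationAt_ne_zero hx0)).symm
      have h3 : (WithZero.log (valuationAt L Q x) - K Q).toNat ≤ n :=
        Finset.le_sup (f := fun Q => (WithZero.log (valuationAt L Q x) - K Q).toNat) hQ
      rw [h2]
      refine (mul_le_mul_left h1 _).trans ?_
      rw [← WithZero.exp_add, WithZero.exp_le_exp]
      lia
    · have h : Q ∉ K.support ∪ (finite_setOf_valuationAt_ne_one L hx0).toFinset :=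
        fun h => hQ (Finset.mem_erase.mpr ⟨hQP, h⟩)
      simp only [Finset.mem_union, Finsupp.mem_support_iff, Set.Finite.mem_toFinset,
        Set.mem_ofPred_eq, not_or, not_not] at h
      rw [h.1, h.2, mul_one, WithZero.exp_zero]
      exact valuationAt_algebraMap_le_one L Q b

variable (L) in
/-- A nonzero element of `A ∩ A(K)`. -/
theorem exists_ne_zero_forall_valuationAt_le (K : WeilDivisor A ℤ) :
    ∃ s : A, s ≠ 0 ∧ ∀ Q, valuationAt L Q (algebraMap A L s) ≤ WithZero.exp (K Q) := by
  let n : ℕ := K.support.sup fun Q => (- K Q).toNat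
  obtain ⟨b, hb, hbS⟩ := exists_notMem_forall_mem_pow (⊥ : Ideal A) K.support (fun Q _ hQ =>
    Ideal.ne_bot_of_height_eq_one Q.2 (le_bot_iff.mp hQ)) n
  refine ⟨b, hb, fun Q => ?_⟩
  by_cases hQ : Q ∈ K.support
  · refine (valuationAt_algebraMap_le_exp L (hbS Q hQ)).trans ?_
    have h3 : (- K Q).toNat ≤ n := Finset.le_sup (f := fun Q => (- K Q).toNat) hQ
    rw [WithZero.exp_le_exp]
    lia
  · rw [Finsupp.notMem_support_iff.mp hQ, WithZero.exp_zero]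
    exact valuationAt_algebraMap_le_one L Q b

/-- Multiplication by a nonzero `s ∈ A ∩ A(-⌊D⌋)` embeds `A(D)` into the Noetherian module `A`. -/
instance divisorialModule.finite (D : WeilDivisor A ℚ) : Module.Finite A (divisorialModule L D) := by
  let K : WeilDivisor A ℤ := Finsupp.mapRange (fun t : ℚ => -⌊t⌋) (by simp) D
  obtain ⟨s, hs, hsK⟩ := exists_ne_zero_forall_valuationAt_le L K
  have hs0 : algebraMap A L s ≠ 0 := by simpa using hs
  let R : Submodule A L := LinearMap.range (Algebra.linearMap A L)
  let f : divisorialModule L D →ₗ[A] R :=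
    ((LinearMap.lsmul A L s) ∘ₗ (divisorialModule L D).subtype).codRestrict R fun x => by
      refine exists_algebraMap_eq_of_valuationAt_le_one fun P => ?_
      rw [LinearMap.comp_apply, LinearMap.lsmul_apply, Algebra.smul_def, map_mul]
      refine (mul_le_mul' (hsK P) (mem_divisorialModule_iff.mp x.2 P)).trans ?_
      rw [← WithZero.exp_add, ← WithZero.exp_zero, WithZero.exp_le_exp]
      simp [K]
  refine Module.Finite.of_injective f fun x y hxy => Subtype.ext ?_
  have : s • x.1 = s • y.1 := congr(($hxy).1)
  rw [Algebra.smul_def, Algebra.smul_def] at this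
  exact mul_left_cancel₀ hs0 this

end DivisorialModules

/-! ### Finiteness and splitting under restriction along Frobenius -/

theorem RingHom.Finite.moduleFinite_restrictScalars {R S : Type u} [CommRing R] [CommRing S]
    {f : R →+* S} (hf : f.Finite) (M : ModuleCat.{u} S) [Module.Finite S M] :
    Module.Finite R ((ModuleCat.restrictScalars f).obj M) := by
  algebraize [f]
  let N : Type u := (ModuleCat.restrictScalars f).obj M
  let _ : Module S N := inferInstanceAs (Module S M)
  have : Module.Finite S N := inferInstanceAs (Module.Finite S M)
  have : IsScalarTower R S N := IsScalarTower.of_algebraMap_smul fun _ _ => rfl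
  exact Module.Finite.trans S N

theorem IsFFinite.iterateFrobenius_finite {A : Type*} [CommRing A] {p : ℕ} [Fact p.Prime]
    [CharP A p] (h : IsFFinite A p) (e : ℕ) : (iterateFrobenius A p e).Finite := by
  induction e with
  | zero => rw [iterateFrobenius_zero]; exact RingHom.Finite.id A
  | succ n ih =>
    rw [iterateFrobenius_add, iterateFrobenius_one]
    exact ih.comp h

theorem isSplitMono_semilinearMapAddEquiv_comp_iff {R : Type u} [CommRing R] (σ : R →+* R)
    {X M : Type u} [AddCommGroup X] [Module R X] [AddCommGroup M] [Module R M]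
    (f : X →ₛₗ[σ] M) (c : R) :
    IsSplitMono (ModuleCat.semilinearMapAddEquiv σ (ModuleCat.of R X) (ModuleCat.of R M) f ≫
        (ModuleCat.restrictScalars σ).map (ModuleCat.ofHom (LinearMap.lsmul R M c))) ↔
      ∃ φ : M →+ X, (∀ a m, φ (σ a • m) = a • φ m) ∧ ∀ x, φ (c • f x) = x := by
  constructor
  · rintro ⟨⟨r, hr⟩⟩
    refine ⟨r.hom.toAddMonoidHom, fun a m => r.hom.map_smul a m, fun x => ?_⟩
    exact congr(($hr).hom x)
  · rintro ⟨φ, h1, h2⟩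
    let r : (ModuleCat.restrictScalars σ).obj (ModuleCat.of R M) ⟶ ModuleCat.of R X :=
      ModuleCat.ofHom (X := (ModuleCat.restrictScalars σ).obj (ModuleCat.of R M))
        { toFun := φ, map_add' := φ.map_add, map_smul' := h1 }
    exact ⟨⟨r, ModuleCat.hom_ext (LinearMap.ext h2)⟩⟩

/-! ### Independence of the Frobenius retraction from the integral divisor -/

section Twist

variable {A : Type*} [CommRing A] [IsDomain A] [IsNoetherianRing A] [IsIntegrallyClosed A]
variable {L : Type*} [Field L] [Algebra A L] [IsFractionRing A L]

theorem WeilDivisor.toRat_apply {A : Type*} [CommRing A] (K : WeilDivisor A ℤ)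
    (P : HeightOnePrime A) : K.toRat P = K P := by
  simp [WeilDivisor.toRat]

theorem mem_divisorialModule_toRat_iff {K : WeilDivisor A ℤ} {f : L} :
    f ∈ divisorialModule L K.toRat ↔ ∀ P, valuationAt L P f ≤ WithZero.exp (K P) := by
  simp [mem_divisorialModule_iff, WeilDivisor.toRat_apply]

theorem mem_divisorialModule_smul_toRat_add_iff {K : WeilDivisor A ℤ} {D : WeilDivisor A ℚ}
    {q : ℕ} {f : L} :
    f ∈ divisorialModule L ((q : ℚ) • K.toRat + D) ↔
      ∀ P, valuationAt L P f ≤ WithZero.exp (q * K P + ⌊D P⌋) := by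
  have (P : HeightOnePrime A) : ⌊((q : ℚ) • K.toRat + D) P⌋ = q * K P + ⌊D P⌋ := by
    rw [Finsupp.add_apply, Finsupp.smul_apply, WeilDivisor.toRat_apply, smul_eq_mul,
      ← Int.floor_intCast_add]
    push_cast
    rfl
  simp only [mem_divisorialModule_iff, this]

theorem mul_mem_divisorialModule_toRat {K₁ K₂ : WeilDivisor A ℤ} {t f : L}
    (ht : ∀ P, valuationAt L P t ≤ WithZero.exp ((K₁ - K₂) P))
    (hf : f ∈ divisorialModule L K₂.toRat) : t * f ∈ divisorialModule L K₁.toRat := by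
  rw [mem_divisorialModule_toRat_iff] at hf ⊢
  intro P
  rw [map_mul]
  refine (mul_le_mul' (ht P) (hf P)).trans ?_
  rw [← WithZero.exp_add, WithZero.exp_le_exp, Finsupp.sub_apply, sub_add_cancel]

theorem pow_mul_mem_divisorialModule {K₁ K₂ : WeilDivisor A ℤ} {D : WeilDivisor A ℚ} {q : ℕ}
    {t x : L} (ht : ∀ P, valuationAt L P t ≤ WithZero.exp ((K₁ - K₂) P))
    (hx : x ∈ divisorialModule L ((q : ℚ) • K₂.toRat + D)) :
    t ^ q * x ∈ divisorialModule L ((q : ℚ) • K₁.toRat + D) := by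
  rw [mem_divisorialModule_smul_toRat_add_iff] at hx ⊢
  intro P
  rw [map_mul, map_pow]
  refine (mul_le_mul' (pow_le_pow_left' (ht P) q) (hx P)).trans ?_
  rw [← WithZero.exp_nsmul, ← WithZero.exp_add, WithZero.exp_le_exp, Finsupp.sub_apply,
    nsmul_eq_mul]
  exact le_of_eq (by ring)

variable (L) in
/-- The map `A(K) → A(qK + D)^{1/q}`, `f ↦ (c f ^ q)^{1/q}`, has an `A`-linear retraction. -/
def HasFrobeniusRetraction (q : ℕ) (c : A) (K : WeilDivisor A ℤ) (D : WeilDivisor A ℚ) : Prop :=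
  ∃ φ : divisorialModule L ((q : ℚ) • K.toRat + D) →+ divisorialModule L K.toRat,
    (∀ (a : A) x, φ (a ^ q • x) = a • φ x) ∧
      ∀ (f : divisorialModule L K.toRat) (x : divisorialModule L ((q : ℚ) • K.toRat + D)),
        (x : L) = algebraMap A L c * (f : L) ^ q → φ x = f

/-- The existence of a retraction does not change if `K` is replaced by another integral
divisor. -/
theorem HasFrobeniusRetraction.twist {q : ℕ} {c : A} {K₁ : WeilDivisor A ℤ} {D : WeilDivisor A ℚ}
    (h : HasFrobeniusRetraction L q c K₁ D) (K₂ : WeilDivisor A ℤ) :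
    HasFrobeniusRetraction L q c K₂ D := by
  obtain ⟨φ, hφ, hφc⟩ := h
  -- Multiplication by `t^q` for `t ∈ A(K₁ - K₂)`.
  let m (t : L) (ht : ∀ P, valuationAt L P t ≤ WithZero.exp ((K₁ - K₂) P)) :
      divisorialModule L ((q : ℚ) • K₂.toRat + D) →+
        divisorialModule L ((q : ℚ) • K₁.toRat + D) :=
    { toFun x := ⟨t ^ q * x, pow_mul_mem_divisorialModule ht x.2⟩
      map_zero' := Subtype.ext (mul_zero _)
      map_add' x y := Subtype.ext (mul_add _ _ _) }
  have coe_m (t : L) (ht x) : (m t ht x : L) = t ^ q * x := rfl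
  -- Thus `t⁻¹ φ(t^q x)` is the same for all nonzero `t`: with `t/u = a/b`, one has `b^q t^q = a^q
  -- u^q`, and `φ` is semilinear.
  have hm (t u : L) (ht hu x) (hu0 : u ≠ 0) : u * φ (m t ht x) = t * φ (m u hu x) := by
    obtain ⟨a, b, hb, hab⟩ := IsFractionRing.div_surjective (A := A) (t / u)
    have hb0 : algebraMap A L b ≠ 0 := by simpa using nonZeroDivisors.ne_zero hb
    rw [div_eq_div_iff hb0 hu0] at hab
    have h1 : b ^ q • m t ht x = a ^ q • m u hu x := Subtype.ext <| by
      rw [Submodule.coe_smul, Submodule.coe_smul, coe_m t ht, coe_m u hu, Algebra.smul_def,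
        Algebra.smul_def, map_pow, map_pow]
      rw [← mul_assoc, ← mul_assoc, ← mul_pow, ← mul_pow, hab, mul_comm t]
    have h2 := congr((φ $h1 : L))
    rw [hφ, hφ, Submodule.coe_smul, Submodule.coe_smul, Algebra.smul_def, Algebra.smul_def] at h2
    refine mul_left_cancel₀ hb0 ?_
    linear_combination u * h2 + φ (m u hu x) * hab
  obtain ⟨s, hs, hsK⟩ := exists_ne_zero_forall_valuationAt_le L (K₁ - K₂)
  have hs0 : algebraMap A L s ≠ 0 := by simpa using hs
  -- The bound is checked at each `P` separately, after replacing `s` by an element `u` of `A(K₁ -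
  -- K₂)` that generates it locally at `P`.
  have hmem (x) : (algebraMap A L s)⁻¹ * φ (m _ hsK x) ∈ divisorialModule L K₂.toRat := by
    rw [mem_divisorialModule_toRat_iff]
    intro P
    obtain ⟨u, hu0, huP, hu⟩ := exists_valuationAt_eq_exp_forall_le L (K₁ - K₂) P
    have h1 : (algebraMap A L s)⁻¹ * φ (m _ hsK x) = u⁻¹ * φ (m u hu x) := by
      have := hm _ u hsK hu x hu0
      field_simp
      linear_combination this
    rw [h1, map_mul, map_inv₀, huP]
    refine (mul_le_mul_right (mem_divisorialModule_toRat_iff.mp (φ (m u hu x)).2 P) _).trans ?_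
    rw [← WithZero.exp_neg, ← WithZero.exp_add, WithZero.exp_le_exp, Finsupp.sub_apply]
    lia
  refine ⟨⟨⟨fun x => ⟨_, hmem x⟩, ?_⟩, fun x y => ?_⟩, fun a x => ?_, fun f x hx => ?_⟩
  · exact Subtype.ext (by simp)
  · exact Subtype.ext (by simp [mul_add])
  · have h1 : m _ hsK (a ^ q • x) = a ^ q • m _ hsK x := Subtype.ext <| by
      rw [Submodule.coe_smul, coe_m _ hsK, coe_m _ hsK, Submodule.coe_smul, mul_smul_comm]
    refine Subtype.ext ?_
    change _ * (φ (m _ hsK (a ^ q • x)) : L) = a • (_ * (φ (m _ hsK x) : L))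
    rw [h1, hφ, Submodule.coe_smul, mul_smul_comm]
  -- Here `s^q · c f^q = c (s f)^q`, which `φ` sends to `s f`.
  · have h1 := hφc ⟨_, mul_mem_divisorialModule_toRat hsK f.2⟩ (m _ hsK x) (by
      rw [coe_m _ hsK, hx, mul_pow, mul_left_comm])
    refine Subtype.ext ?_
    change _ * (φ (m _ hsK x) : L) = f
    rw [h1, inv_mul_cancel_left₀ hs0]

end Twist

/-! ### Splitting versus injectivity on local cohomology -/

section Main

theorem rootMul_one {A : Type u} [CommRing A] (p : ℕ) [Fact p.Prime] [CharP A p] (e : ℕ) (M : ModuleCat.{u} A) : rootMul p e (1 : A) M = 𝟙 _ := by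
  rw [rootMul, ← CategoryTheory.Functor.map_id]
  congr 1
  ext x
  exact one_smul A x

variable {A : Type u} [CommRing A] [IsDomain A] [IsNoetherianRing A] [IsIntegrallyClosed A]
variable {p : ℕ} [Fact p.Prime] [CharP A p]
variable {L : Type u} [Field L] [Algebra A L] [IsFractionRing A L]

theorem hasFrobeniusRetraction_iff_isSplitMono {e : ℕ} {c : A} {K : WeilDivisor A ℤ}
    {Δ : WeilDivisor A ℚ} (hΔ : 0 ≤ Δ) :
    HasFrobeniusRetraction L (p ^ e) c K (qSubOne p e Δ) ↔
      IsSplitMono (frobeniusRootMap p L e K hΔ ≫ rootMul p e c (twistedModule p L e K Δ)) := by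
  refine Iff.trans ?_ (isSplitMono_semilinearMapAddEquiv_comp_iff _
    (frobeniusSemilinear p L e K (qSubOne_nonneg p e hΔ)) c).symm
  refine exists_congr fun φ => and_congr Iff.rfl
    ⟨fun h f => h f _ (Algebra.smul_def _ _), fun h f x hx => ?_⟩
  rw [← h f]
  exact congrArg φ (Subtype.ext (hx.trans (Algebra.smul_def _ _).symm))

/-- This is the retraction problem at `K = 0`, because `A(0) = A` for a normal Noetherian domain;
`ι` and `κ` are the resulting identifications. -/
theorem splitsAt_iff_hasFrobeniusRetraction {e : ℕ} {c : A} {D : WeilDivisor A ℚ} (hD : 0 ≤ D) :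
    SplitsAt p L e c hD ↔ HasFrobeniusRetraction L (p ^ e) c 0 D := by
  have hA (x : L) : x ∈ divisorialModule L (0 : WeilDivisor A ℤ).toRat ↔
      x ∈ LinearMap.range (Algebra.linearMap A L) := by
    rw [mem_divisorialModule_toRat_iff]
    refine ⟨fun h => exists_algebraMap_eq_of_valuationAt_le_one fun P => ?_, ?_⟩
    · simpa using h P
    · rintro ⟨a, rfl⟩ P
      simpa using valuationAt_algebraMap_le_one L P a
  let ι : A ≃ₗ[A] divisorialModule L (0 : WeilDivisor A ℤ).toRat :=
    (LinearEquiv.ofInjective (Algebra.linearMap A L) (IsFractionRing.injective A L)).trans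
      (LinearEquiv.ofEq _ _ (Submodule.ext fun x => (hA x).symm))
  have hι (a : A) : (ι a : L) = algebraMap A L a := rfl
  let κ : divisorialModule L D ≃ₗ[A]
      divisorialModule L (((p ^ e : ℕ) : ℚ) • (0 : WeilDivisor A ℤ).toRat + D) :=
    LinearEquiv.ofEq _ _ <| Submodule.ext fun x => by
      rw [mem_divisorialModule_smul_toRat_add_iff, mem_divisorialModule_iff]
      simp
  have hκ (x) : (κ x : L) = x := rfl
  have hκ' (x) : (κ.symm x : L) = x := rfl
  refine (isSplitMono_semilinearMapAddEquiv_comp_iff _ (inclusionSemilinear p L e hD) c).trans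
    ⟨?_, ?_⟩
  · rintro ⟨φ, h1, h2⟩
    refine ⟨ι.toAddMonoidHom.comp (φ.comp κ.symm.toAddMonoidHom), fun a x => ?_, fun f x hx => ?_⟩
    · change ι (φ (κ.symm (a ^ p ^ e • x))) = a • ι (φ (κ.symm x))
      rw [map_smul κ.symm, ← map_smul ι, ← h1, iterateFrobenius_def]
    · obtain ⟨a, rfl⟩ := ι.surjective f
      have h3 : κ.symm x = c • inclusionSemilinear p L e hD a := Subtype.ext <| by
        rw [hκ', hx, hι, Submodule.coe_smul, Algebra.smul_def, ← map_pow]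
        rfl
      change ι (φ (κ.symm x)) = _
      rw [h3, h2]
  · rintro ⟨φ, h1, h2⟩
    refine ⟨ι.symm.toAddMonoidHom.comp (φ.comp κ.toAddMonoidHom), fun a x => ?_, fun a => ?_⟩
    · change ι.symm (φ (κ (iterateFrobenius A p e a • x))) = a • ι.symm (φ (κ x))
      rw [iterateFrobenius_def, map_smul, h1, map_smul]
    · change ι.symm (φ (κ _)) = a
      rw [LinearEquiv.symm_apply_eq]
      refine h2 _ _ ?_
      rw [hκ, hι, Submodule.coe_smul, Algebra.smul_def, ← map_pow]
      rfl

variable [IsLocalRing A]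

/-- Duality turns injectivity into a retraction for the canonical divisor `K`, and twisting moves it
between `K` and `0`. -/
theorem injective_mulFrobeniusLC_iff_splitsAt (hF : IsFFinite A p) {d : ℕ}
    (hd : ringKrullDim A = d) {K : WeilDivisor A ℤ} (hK : IsCanonicalDivisor L d K)
    {Δ : WeilDivisor A ℚ} (hΔ : 0 ≤ Δ) (e : ℕ) (c : A) :
    Function.Injective (mulFrobeniusLC p L d e c K hΔ) ↔
      SplitsAt p L e c (qSubOne_nonneg p e hΔ) := by
  have := (hF.iterateFrobenius_finite e).moduleFinite_restrictScalars (twistedModule p L e K Δ)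
  rw [splitsAt_iff_hasFrobeniusRetraction, mulFrobeniusLC, frobeniusLC, ← Functor.map_comp,
    IsCanonicalModule.map_injective_iff hd hK, ← hasFrobeniusRetraction_iff_isSplitMono]
  exact ⟨fun h => h.twist 0, fun h => h.twist K⟩

theorem injective_frobeniusLC_iff_isSplitMono (hF : IsFFinite A p) {d : ℕ}
    (hd : ringKrullDim A = d) {K : WeilDivisor A ℤ} (hK : IsCanonicalDivisor L d K)
    {Δ : WeilDivisor A ℚ} (hΔ : 0 ≤ Δ) (e : ℕ) :
    Function.Injective (frobeniusLC p L d e K hΔ) ↔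
      IsSplitMono (inclusionRoot p L e (qSubOne_nonneg p e hΔ)) := by
  have := injective_mulFrobeniusLC_iff_splitsAt hF hd hK hΔ e 1
  rwa [mulFrobeniusLC, SplitsAt, rootMul_one, rootMul_one, CategoryTheory.Functor.map_id,
    Category.comp_id, Category.comp_id] at this

end Main

end

theorem proposition2p4 {A : Type u} [CommRing A] [IsDomain A] [IsNoetherianRing A]
    [IsIntegrallyClosed A] [IsLocalRing A] (p : ℕ) [Fact p.Prime] [CharP A p]
    (hF : IsFFinite A p) (d : ℕ) (hd : ringKrullDim A = d)
    (L : Type u) [Field L] [Algebra A L] [IsFractionRing A L]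
    (K : WeilDivisor A ℤ) (hK : IsCanonicalDivisor L d K)
    (Δ : WeilDivisor A ℚ) (hΔ : 0 ≤ Δ) :
    (IsFPurePair p L hΔ ↔
      ∀ e : ℕ, 1 ≤ e → Function.Injective (frobeniusLC p L d e K hΔ)) ∧
    (IsStronglyFRegularPair p L hΔ ↔
      ∀ c : A, c ≠ 0 → ∃ e : ℕ, 1 ≤ e ∧ Function.Injective (mulFrobeniusLC p L d e c K hΔ)) ∧
    (IsDivisoriallyFRegularPair p L hΔ ↔
      ∀ c : A, IsAdmissible L Δ c →
        ∃ e : ℕ, 1 ≤ e ∧ Function.Injective (mulFrobeniusLC p L d e c K hΔ)) := by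
  exact ⟨forall₂_congr fun e _ => (injective_frobeniusLC_iff_isSplitMono hF hd hK hΔ e).symm,
    forall₂_congr fun c _ => exists_congr fun e => and_congr_right fun _ =>
      (injective_mulFrobeniusLC_iff_splitsAt hF hd hK hΔ e c).symm,
    forall₂_congr fun c _ => exists_congr fun e => and_congr_right fun _ =>
      (injective_mulFrobeniusLC_iff_splitsAt hF hd hK hΔ e c).symm⟩
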